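/- Write $e(x)=e^{2\pi i x}$ and let $\mathbb H$ be the upper half plane. An integral lattice $\underline L=(L,\beta)$ of rank $n$ is a free $\mathbb Z$-module $L$ of rank $n$ with a symmetric $\mathbb Z$-valued bilinear form $\beta$; put $\beta(x)=\tfrac12\beta(x,x)$, and use $\beta$ also for the extension to $\mathbb Q\otimes L$ and $\mathbb C\otimes L$. It is positive definite if $\beta(x)>0$ for all $0\ne x\in L$, even if $\beta(x,x)$ is even for all $x\in L$, and unimodular if $x\mapsto\beta(x,\cdot)$ is an isomorphism $L\to\mathrm{Hom}(L,\mathbb Z)$. Two integral lattices $\underline L_1,\underline L_2$ are called stably equivalent (resp. even stably equivalent) if there are integral unimodular (resp. even unimodular) lattices $\underline U_1,\underline U_2$, not necessarily definite, such that the orthogonal sums $\underline L_1\perp\underline U_1$ and $\underline L_2\perp\underline U_2$ are isometric. Let $G=\mathrm{Mp}(2,\mathbb Z)$ be the group of pairs $(A,w)$ with $A=\begin{pmatrix}a&b\\c&d\end{pmatrix}\in\mathrm{SL}(2,\mathbb Z)$ and $w$ a holomorphic function on $\mathbb H$ with $w(\tau)^2=c\tau+d$, with multiplication $(A,w)(B,v)=(AB,\,w(B\tau)v(\tau))$.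 Let $\varepsilon(A,w)=\eta(A\tau)/(\eta(\tau)w(\tau))$, where $\eta$ is the Dedekind eta function; this is independent of $\tau$ and a linear character of $G$. For a linear character $\chi$ of $G$ let $\mathbb C(\chi)$ be $\mathbb C$ with $G$ acting through $\chi$. For an integral positive definite lattice $\underline L=(L,\beta)$ of rank $n$ let $$L^\bullet=\{r\in\mathbb Q\otimes L:\ \beta(r,x)\equiv\beta(x)\bmod\mathbb Z\ \text{ for all } x\in L\},$$ let $W(\underline L)$ be the space of maps $\lambda:L^\bullet\to\mathbb C$ such that $\lambda(r+x)=e(\beta(x))\lambda(r)$ for all $r\in L^\bullet$, $x\in L$, and let $\Theta(\underline L)$ be the space of the functions $$\vartheta_{\underline L,\lambda}(\tau,z)=\sum_{r\in L^\bullet}\lambda(r)\,e(\tau\beta(r))\,e(\beta(r,z))\qquad(\tau\in\mathbb H,\ z\in\mathbb C\otimes L),\quad \lambda\in W(\underline L).$$ The group $G$ acts on functions $\phi$ on $\mathbb H\times(\mathbb C\otimes L)$ from the left by $(\alpha,\phi)\mapsto\phi|\alpha^{-1}$, where, for $\alpha=(A,w)$ as above, $$(\phi|\alpha)(\tau,z)=\phi\Big(\frac{a\tau+b}{c\tau+d},\frac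 z{c\tau+d}\Big)\,e\Big(\frac{-c\,\beta(z)}{c\tau+d}\Big)\,w(\tau)^{-n}.$$ **Theorem.** Let $\underline L_1$ and $\underline L_2$ be integral positive definite lattices of rank $n_1$ and $n_2$, respectively. Then $\Theta(\underline L_1)$ and $\Theta(\underline L_2)$ are stable under the action of $G$. If $\underline L_1$ and $\underline L_2$ are stably equivalent, then $$\Theta(\underline L_1)\otimes\mathbb C(\varepsilon^{3n_1})\;\cong\;\Theta(\underline L_2)\otimes\mathbb C(\varepsilon^{3n_2})$$ as $G$-modules. If $\underline L_1$ and $\underline L_2$ are even stably equivalent, then $\Theta(\underline L_1)\cong\Theta(\underline L_2)$ as $G$-modules. -/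

import Mathlib

open UpperHalfPlane TensorProduct
open scoped MatrixGroups Manifold

universe u v

namespace LatticeTheta

noncomputable section

/-! ### The metaplectic cover of the modular group -/

/-- The automorphy factor `c τ + d` of a matrix with lower row `(c, d)`. -/
def autFactor (A : SL(2, ℤ)) (τ : ℍ) : ℂ := (A 1 0 : ℂ) * (τ : ℂ) + (A 1 1 : ℂ)

theorem autFactor_eq_denom (A : SL(2, ℤ)) (τ : ℍ) : autFactor A τ = denom A τ := by
  simp [autFactor, denom]

theorem autFactor_ne_zero (A : SL(2, ℤ)) (τ : ℍ) : autFactor A τ ≠ 0 := by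
  rw [autFactor_eq_denom]; exact denom_ne_zero _ τ

theorem coe_smul_eq (A : SL(2, ℤ)) (τ : ℍ) :
    ((A • τ : ℍ) : ℂ) = ((A 0 0 : ℂ) * τ + (A 0 1 : ℂ)) / autFactor A τ := by
  rw [coe_specialLinearGroup_apply]
  simp [autFactor]

theorem det_eq_one (A : SL(2, ℤ)) : (A 0 0 : ℂ) * (A 1 1 : ℂ) - (A 0 1 : ℂ) * (A 1 0 : ℂ) = 1 := by
  have h := A.det_coe
  rw [Matrix.det_fin_two] at h
  exact_mod_cast h

theorem mul_lower_left (A B : SL(2, ℤ)) :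
    ((A * B) 1 0 : ℂ) = (A 1 0 : ℂ) * (B 0 0 : ℂ) + (A 1 1 : ℂ) * (B 1 0 : ℂ) := by
  simp [Matrix.mul_apply, Fin.sum_univ_two]

theorem mul_lower_right (A B : SL(2, ℤ)) :
    ((A * B) 1 1 : ℂ) = (A 1 0 : ℂ) * (B 0 1 : ℂ) + (A 1 1 : ℂ) * (B 1 1 : ℂ) := by
  simp [Matrix.mul_apply, Fin.sum_univ_two]

theorem autFactor_mul (A B : SL(2, ℤ)) (τ : ℍ) :
    autFactor (A * B) τ = autFactor A (B • τ) * autFactor B τ := by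
  have hB := autFactor_ne_zero B τ
  have h : autFactor A (B • τ) * autFactor B τ =
      (A 1 0 : ℂ) * ((B 0 0 : ℂ) * τ + (B 0 1 : ℂ)) + (A 1 1 : ℂ) * autFactor B τ := by
    rw [autFactor, coe_smul_eq]
    field_simp
  rw [h, autFactor, mul_lower_left, mul_lower_right, autFactor]
  ring

theorem autFactor_one (τ : ℍ) : autFactor 1 τ = 1 := by
  simp [autFactor]

theorem mdifferentiable_sl_smul (A : SL(2, ℤ)) :
    MDiff (fun τ : ℍ ↦ A • τ) :=
  mdifferentiable_smul (g := (A : GL (Fin 2) ℝ)) (by simp)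

/-- The metaplectic cover of `SL(2, ℤ)`: pairs `(A, w)` of a matrix `A` with lower row `(c, d)` and
a holomorphic square root `w` of `τ ↦ c τ + d` on the upper half plane. -/
@[ext]
structure Mp where
  mat : SL(2, ℤ)
  root : ℍ → ℂ
  holo : MDiff root
  root_sq : ∀ τ, root τ ^ 2 = autFactor mat τ

namespace Mp

theorem root_ne_zero (α : Mp) (τ : ℍ) : α.root τ ≠ 0 := by
  intro h
  have := α.root_sq τ
  rw [h] at this
  exact autFactor_ne_zero α.mat τ (by simpa using this.symm)

instance : Mul Mp where
  mul α β :=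
    { mat := α.mat * β.mat
      root := fun τ ↦ α.root (β.mat • τ) * β.root τ
      holo := (α.holo.comp (mdifferentiable_sl_smul β.mat)).mul β.holo
      root_sq := fun τ ↦ by rw [mul_pow, α.root_sq, β.root_sq, autFactor_mul] }

instance : One Mp where
  one :=
    { mat := 1
      root := fun _ ↦ 1
      holo := mdifferentiable_const
      root_sq := fun τ ↦ by rw [autFactor_one, one_pow] }

theorem mdiff_inv {f : ℍ → ℂ} (hf : MDiff f) (h0 : ∀ τ, f τ ≠ 0) : MDiff (fun τ ↦ (f τ)⁻¹) := by
  rw [mdifferentiable_iff] at hf ⊢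
  exact hf.inv fun z _ ↦ h0 _

instance : Inv Mp where
  inv α :=
    { mat := α.mat⁻¹
      root := fun τ ↦ (α.root (α.mat⁻¹ • τ))⁻¹
      holo := mdiff_inv (α.holo.comp (mdifferentiable_sl_smul α.mat⁻¹)) fun τ ↦ α.root_ne_zero _
      root_sq := fun τ ↦ by
        have h := autFactor_mul α.mat α.mat⁻¹ τ
        rw [mul_inv_cancel, autFactor_one] at h
        rw [inv_pow, α.root_sq, inv_eq_of_mul_eq_one_right h.symm] }

@[simp] theorem mat_mul (α β : Mp) : (α * β).mat = α.mat * β.mat := rfl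
@[simp] theorem root_mul (α β : Mp) (τ : ℍ) :
    (α * β).root τ = α.root (β.mat • τ) * β.root τ := rfl
@[simp] theorem mat_one : (1 : Mp).mat = 1 := rfl
@[simp] theorem root_one (τ : ℍ) : (1 : Mp).root τ = 1 := rfl
@[simp] theorem mat_inv (α : Mp) : (α⁻¹).mat = (α.mat)⁻¹ := rfl
@[simp] theorem root_inv (α : Mp) (τ : ℍ) : (α⁻¹).root τ = (α.root (α.mat⁻¹ • τ))⁻¹ := rfl

/-- The multiplication is `(A, w) (B, v) = (A B, w(B τ) v(τ))`. -/
instance : Group Mp :=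
  Group.ofLeftAxioms
    (fun α β γ ↦ by
      ext τ
      · simp [mul_assoc]
      · simp [mul_assoc, mul_smul])
    (fun α ↦ by
      ext τ
      · simp
      · simp)
    (fun α ↦ by
      ext τ
      · simp
      · simp [α.root_ne_zero])

end Mp

/-! ### The character of the Dedekind eta function -/

/-- The quotient `η(A τ) / (η(τ) w(τ))`. -/
def etaQuotient (α : Mp) (τ : ℍ) : ℂ :=
  ModularForm.eta (α.mat • τ : ℍ) / (ModularForm.eta τ * α.root τ)

theorem eta_coe_ne_zero (τ : ℍ) : ModularForm.eta τ ≠ 0 :=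
  ModularForm.eta_ne_zero τ.im_pos

theorem continuous_eta_coe : Continuous fun τ : ℍ ↦ ModularForm.eta τ :=
  continuous_iff_continuousAt.2 fun τ ↦
    (ModularForm.differentiableAt_eta_of_mem_upperHalfPlaneSet τ.im_pos).continuousAt.comp
      UpperHalfPlane.continuous_coe.continuousAt

theorem etaQuotient_pow (α : Mp) (τ : ℍ) : etaQuotient α τ ^ 24 = 1 := by
  have h : ModularForm.eta (α.mat • τ : ℍ) ^ 24 =
      autFactor α.mat τ ^ 12 * ModularForm.eta τ ^ 24 := by
    have := SlashInvariantForm.slash_action_eqn''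
      CuspForm.discriminant (γ := (α.mat : GL (Fin 2) ℝ))
      (MonoidHom.mem_range.2 ⟨α.mat, rfl⟩) τ
    rw [autFactor_eq_denom]
    exact_mod_cast this
  have hw : α.root τ ^ 24 = autFactor α.mat τ ^ 12 := by
    rw [← α.root_sq, ← pow_mul]
  rw [etaQuotient, div_pow, mul_pow, h, hw, mul_comm]
  exact div_self (mul_ne_zero (pow_ne_zero _ (eta_coe_ne_zero τ))
    (pow_ne_zero _ (autFactor_ne_zero _ _)))

theorem continuous_etaQuotient (α : Mp) : Continuous (etaQuotient α) := by
  refine Continuous.div ?_ (continuous_eta_coe.mul α.holo.continuous)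
    fun τ ↦ mul_ne_zero (eta_coe_ne_zero τ) (α.root_ne_zero τ)
  exact continuous_eta_coe.comp (mdifferentiable_sl_smul α.mat).continuous

/-- The quotient `η(A τ) / (η(τ) w(τ))` does not depend on `τ`. -/
theorem etaQuotient_const (α : Mp) (τ σ : ℍ) : etaQuotient α τ = etaQuotient α σ := by
  have hfin : {z : ℂ | z ^ 24 = 1}.Finite := by
    refine (Polynomial.nthRoots 24 (1 : ℂ)).toFinset.finite_toSet.subset fun z hz ↦ ?_
    simpa using (Polynomial.mem_nthRoots (by norm_num)).2 hz
  have hpre : IsPreconnected (Set.range (etaQuotient α)) :=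
    isPreconnected_range (continuous_etaQuotient α)
  have hsub : Set.range (etaQuotient α) ⊆ {z : ℂ | z ^ 24 = 1} := by
    rintro _ ⟨τ, rfl⟩
    exact etaQuotient_pow α τ
  exact hfin.countable.isTotallyDisconnected _ hsub hpre ⟨τ, rfl⟩ ⟨σ, rfl⟩

theorem etaQuotient_mul (α β : Mp) (τ : ℍ) :
    etaQuotient (α * β) τ = etaQuotient α (β.mat • τ) * etaQuotient β τ := by
  have h1 := eta_coe_ne_zero τ
  have h2 := eta_coe_ne_zero (β.mat • τ)
  have h3 := α.root_ne_zero (β.mat • τ)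
  have h4 := β.root_ne_zero τ
  simp only [etaQuotient, Mp.mat_mul, Mp.root_mul, mul_smul]
  field_simp

theorem etaQuotient_one (τ : ℍ) : etaQuotient 1 τ = 1 := by
  simp [etaQuotient, eta_coe_ne_zero]

/-- The linear character `ε(A, w) = η(A τ) / (η(τ) w(τ))`; the quotient is independent of `τ` by
`etaQuotient_const` and is evaluated at `τ = i`. -/
def epsilon : Mp →* ℂˣ :=
  MonoidHom.toHomUnits
    { toFun := fun α ↦ etaQuotient α UpperHalfPlane.I
      map_one' := etaQuotient_one _
      map_mul' := fun α β ↦ by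
        rw [etaQuotient_mul, etaQuotient_const α (β.mat • UpperHalfPlane.I) UpperHalfPlane.I] }

theorem epsilon_apply (α : Mp) (τ : ℍ) : (epsilon α : ℂ) = etaQuotient α τ :=
  etaQuotient_const α _ _

/-- The one-dimensional `Mp`-module `ℂ(χ)` on which `α` acts as multiplication by `χ(α)`. -/
def charRep (χ : Mp →* ℂˣ) : Representation ℂ Mp ℂ where
  toFun α := LinearMap.lsmul ℂ ℂ (χ α : ℂ)
  map_one' := by ext; simp
  map_mul' α β := by ext; simp

/-! ### Integral lattices -/

/-- An integral lattice: a free `ℤ`-module of finite rank with a symmetric `ℤ`-valued `ℤ`-bilinear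
form. -/
structure IntegralLattice where
  carrier : Type u
  [addCommGroup : AddCommGroup carrier]
  [free : Module.Free ℤ carrier]
  [finite : Module.Finite ℤ carrier]
  form : LinearMap.BilinForm ℤ carrier
  symm : ∀ x y, form x y = form y x

namespace IntegralLattice

instance : CoeSort IntegralLattice.{u} (Type u) := ⟨IntegralLattice.carrier⟩

attribute [instance] addCommGroup free finite

/-- The rank of the lattice. -/
def rank (L : IntegralLattice.{u}) : ℕ := Module.finrank ℤ L

def IsPosDef (L : IntegralLattice.{u}) : Prop := ∀ x : L, x ≠ 0 → 0 < L.form x x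

def IsEven (L : IntegralLattice.{u}) : Prop := ∀ x : L, Even (L.form x x)

/-- Unimodularity: the form identifies the lattice with its `ℤ`-dual. -/
def IsUnimodular (L : IntegralLattice.{u}) : Prop :=
  Function.Bijective (L.form : L → Module.Dual ℤ L)

/-- The orthogonal sum of two lattices. -/
def orthSum (L : IntegralLattice.{u}) (M : IntegralLattice.{v}) : IntegralLattice.{max u v} where
  carrier := L × M
  form := L.form.compl₁₂ (LinearMap.fst ℤ L M) (LinearMap.fst ℤ L M) +
    M.form.compl₁₂ (LinearMap.snd ℤ L M) (LinearMap.snd ℤ L M)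
  symm x y := by simp [L.symm x.1 y.1, M.symm x.2 y.2]

theorem orthSum_form (L : IntegralLattice.{u}) (M : IntegralLattice.{v}) (x y : L × M) :
    (L.orthSum M).form x y = L.form x.1 y.1 + M.form x.2 y.2 := rfl

/-- Two lattices are isomorphic if there is an isometric isomorphism of `ℤ`-modules. -/
def Isomorphic (L : IntegralLattice.{u}) (M : IntegralLattice.{v}) : Prop :=
  ∃ e : L ≃ₗ[ℤ] M, ∀ x y : L, M.form (e x) (e y) = L.form x y

/-- Stable equivalence: the lattices become isomorphic after adding unimodular lattices (of
arbitrary signature). Every lattice is isomorphic to one with carrier in `Type`. -/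
def StablyEquivalent (L : IntegralLattice.{u}) (M : IntegralLattice.{v}) : Prop :=
  ∃ U V : IntegralLattice.{0}, U.IsUnimodular ∧ V.IsUnimodular ∧
    (L.orthSum U).Isomorphic (M.orthSum V)

/-- Even stable equivalence: the lattices become isomorphic after adding even unimodular
lattices. -/
def EvenStablyEquivalent (L : IntegralLattice.{u}) (M : IntegralLattice.{v}) : Prop :=
  ∃ U V : IntegralLattice.{0}, (U.IsUnimodular ∧ U.IsEven) ∧ (V.IsUnimodular ∧ V.IsEven) ∧
    (L.orthSum U).Isomorphic (M.orthSum V)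

variable (L : IntegralLattice.{u})

/-- The rational vector space `ℚ ⊗ L`. -/
abbrev RatSpace : Type u := ℚ ⊗[ℤ] L

/-- The complex vector space `ℂ ⊗ L`. -/
abbrev CplxSpace : Type u := ℂ ⊗[ℤ] L

/-- The `ℚ`-bilinear extension of the form. -/
abbrev formQ : LinearMap.BilinForm ℚ L.RatSpace := L.form.baseChange ℚ

/-- The `ℂ`-bilinear extension of the form. -/
abbrev formC : LinearMap.BilinForm ℂ L.CplxSpace := L.form.baseChange ℂ

/-- The inclusion `L → ℚ ⊗ L`. -/
def toRat (x : L) : L.RatSpace := 1 ⊗ₜ x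

/-- The inclusion `ℚ ⊗ L → ℂ ⊗ L`. -/
def toCplx : L.RatSpace →ₗ[ℤ] L.CplxSpace :=
  LinearMap.rTensor L (algebraMap ℚ ℂ).toIntAlgHom.toLinearMap

/-- The shadow of `L`: the vectors `r` in `ℚ ⊗ L` with `β(r, x) ≡ β(x, x) / 2` modulo `ℤ` for all
`x` in `L`. -/
def shadow : Set L.RatSpace :=
  {r | ∀ x : L, ∃ m : ℤ, L.formQ r (L.toRat x) - (L.form x x : ℚ) / 2 = m}

end IntegralLattice

/-! ### Theta functions -/

/-- `e(x) = exp(2 π i x)`. -/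
def e (x : ℂ) : ℂ := Complex.exp (2 * Real.pi * Complex.I * x)

theorem e_add (x y : ℂ) : e (x + y) = e x * e y := by
  rw [e, mul_add, Complex.exp_add, e, e]

theorem e_zero : e 0 = 1 := by simp [e]

namespace IntegralLattice

variable (L : IntegralLattice.{u})

/-- The space of maps `l` from the shadow to `ℂ` with `l(r + x) = e(β(x, x) / 2) l(r)` for all `x`
in `L`. -/
def W : Submodule ℂ (L.shadow → ℂ) where
  carrier := {l | ∀ (r s : L.shadow) (x : L), (s : L.RatSpace) = r + L.toRat x →
    l s = e ((L.form x x : ℂ) / 2) * l r}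
  add_mem' {l m} hl hm r s x h := by
    simp only [Pi.add_apply, hl r s x h, hm r s x h, mul_add]
  zero_mem' r s x h := by simp
  smul_mem' c l hl r s x h := by
    simp only [Pi.smul_apply, hl r s x h, smul_eq_mul]
    ring

/-- The theta function `∑ l(r) q ^ (β(r, r) / 2) e(β(r, z))`, the sum being over all `r` in the
shadow, where `q ^ a = e(a τ)`. -/
def theta (l : L.shadow → ℂ) (τ : ℍ) (z : L.CplxSpace) : ℂ :=
  ∑' r : L.shadow, l r * e ((L.formQ r r / 2 : ℚ) * (τ : ℂ)) * e (L.formC (L.toCplx r) z)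

/-- The space `Θ(L)` of functions on `ℍ × (ℂ ⊗ L)` spanned by the theta functions attached to the
elements of `W(L)`. -/
def Theta : Submodule ℂ (ℍ → L.CplxSpace → ℂ) :=
  Submodule.span ℂ (L.theta '' (L.W : Set (L.shadow → ℂ)))

/-- The slash action of weight `n / 2` and index `L` on functions on `ℍ × (ℂ ⊗ L)`, where `n` is
the rank of `L`: for `α = (A, w)` with lower row `(c, d)` of `A` it sends `φ` to
`φ(A τ, z / (c τ + d)) e(- c β(z, z) / (2 (c τ + d))) w(τ) ^ (- n)`. -/
def slash (φ : ℍ → L.CplxSpace → ℂ) (α : Mp) : ℍ → L.CplxSpace → ℂ := fun τ z ↦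
  φ (α.mat • τ) ((autFactor α.mat τ)⁻¹ • z) *
    e (-(α.mat 1 0 : ℂ) * (L.formC z z / 2) / autFactor α.mat τ) * (α.root τ)⁻¹ ^ L.rank

theorem slash_one (φ : ℍ → L.CplxSpace → ℂ) : L.slash φ 1 = φ := by
  ext τ z
  simp [slash, autFactor_one, e_zero]

theorem slash_mul (φ : ℍ → L.CplxSpace → ℂ) (α β : Mp) :
    L.slash φ (α * β) = L.slash (L.slash φ α) β := by
  ext τ z
  have hA := autFactor_ne_zero α.mat (β.mat • τ)
  have hB := autFactor_ne_zero β.mat τ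
  have hAB := autFactor_mul α.mat β.mat τ
  have key : (α.mat 1 0 : ℂ) + (β.mat 1 0 : ℂ) * (autFactor α.mat (β.mat • τ) * autFactor β.mat τ) =
      ((α.mat * β.mat) 1 0 : ℂ) * autFactor β.mat τ := by
    rw [← hAB, autFactor, mul_lower_left, mul_lower_right, autFactor]
    linear_combination (-(α.mat 1 0 : ℂ)) * det_eq_one β.mat
  simp only [slash, Mp.mat_mul, Mp.root_mul, mul_smul, hAB]
  have h1 : (autFactor α.mat (β.mat • τ) * autFactor β.mat τ)⁻¹ • z =
      (autFactor α.mat (β.mat • τ))⁻¹ • (autFactor β.mat τ)⁻¹ • z := by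
    rw [smul_smul, mul_inv]
  have h2 : e (-((α.mat * β.mat) 1 0 : ℂ) * (L.formC z z / 2) /
        (autFactor α.mat (β.mat • τ) * autFactor β.mat τ)) =
      e (-(α.mat 1 0 : ℂ) * (L.formC ((autFactor β.mat τ)⁻¹ • z) ((autFactor β.mat τ)⁻¹ • z) / 2) /
        autFactor α.mat (β.mat • τ)) *
      e (-(β.mat 1 0 : ℂ) * (L.formC z z / 2) / autFactor β.mat τ) := by
    rw [← e_add]
    congr 1
    simp only [map_smul, LinearMap.smul_apply, smul_eq_mul]
    field_simp
    linear_combination (L.formC z z) * key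
  rw [h1, h2, mul_inv, mul_pow]
  ring

/-- The left action `(α, φ) ↦ φ | α⁻¹` of `Mp` on functions on `ℍ × (ℂ ⊗ L)`. -/
def slashRep : Representation ℂ Mp (ℍ → L.CplxSpace → ℂ) where
  toFun α :=
    { toFun := fun φ ↦ L.slash φ α⁻¹
      map_add' := fun φ ψ ↦ by ext τ z; simp only [slash, Pi.add_apply]; ring
      map_smul' := fun c φ ↦ by
        ext τ z; simp only [slash, Pi.smul_apply, smul_eq_mul, RingHom.id_apply]; ring }
  map_one' := by
    ext φ : 1
    simp [slash_one]
  map_mul' α β := by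
    ext φ : 1
    simp [slash_mul]

end IntegralLattice

end

end LatticeTheta

/-!
The map `l ↦ θ_l` identifies `W(L)` with `Θ(L)`. Under this identification the generator `T` acts by
multiplication by `e(β(r, r) / 2)`, and `S` acts by the finite Fourier transform over the shadow
modulo `L`, up to a positive constant times `e(-n / 8)`; the latter is Poisson summation, reduced to
the one-dimensional theta function on a sublattice with an orthogonal basis.

Every unimodular lattice `U` has a shadow that is a single coset `u + U`, so `r ↦ (r, u)` identifies
the shadow of `L` modulo `L` with that of `L ⊥ U`, and translation by `u` changes the form by the
constant `k = β(u, u)`. Hence stably equivalent lattices have isomorphic spaces `W`, compatibly with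
the actions of `T` and `S` up to scalars `t = e(± k / 2)` and `s`. The relation `(S T)³ = S²` forces
`s t³ = 1`, and since `s` is known up to a positive constant this determines `t`; the scalars are
therefore the values of a power of the eta character. For even `U` one can take `u = 0`.
-/

namespace LatticeTheta

noncomputable section

/-! ### Exponentials -/

theorem e_neg (x : ℂ) : e (-x) = (e x)⁻¹ := by
  rw [e, mul_neg, Complex.exp_neg, e]

theorem e_ne_zero (x : ℂ) : e x ≠ 0 := Complex.exp_ne_zero _

theorem e_sub (x y : ℂ) : e (x - y) = e x / e y := by
  rw [sub_eq_add_neg, e_add, e_neg, div_eq_mul_inv]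

theorem e_eq_one_iff (x : ℂ) : e x = 1 ↔ ∃ m : ℤ, x = m := by
  rw [e, Complex.exp_eq_one_iff]
  refine exists_congr fun m ↦ ?_
  rw [mul_comm (m : ℂ), mul_right_inj' Complex.two_pi_I_ne_zero]

theorem e_intCast (m : ℤ) : e m = 1 := (e_eq_one_iff _).2 ⟨m, rfl⟩

theorem e_eq_of_sub_eq_intCast {x y : ℂ} {m : ℤ} (h : x - y = m) : e x = e y := by
  rw [← sub_add_cancel x y, h, e_add, e_intCast, one_mul]

theorem e_sum {ι : Type*} (s : Finset ι) (f : ι → ℂ) : e (∑ i ∈ s, f i) = ∏ i ∈ s, e (f i) := by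
  simp only [e, Finset.mul_sum, Complex.exp_sum]

theorem e_natCast_mul (n : ℕ) (x : ℂ) : e (n * x) = e x ^ n := by
  rw [e, e, ← Complex.exp_nat_mul]
  ring_nf

theorem norm_e_ratCast (x : ℚ) : ‖e x‖ = 1 := by
  rw [e, show (2 * Real.pi * Complex.I * (x : ℂ) : ℂ) = ((2 * Real.pi * x : ℝ) : ℂ) * Complex.I by
    push_cast; ring]
  exact Complex.norm_exp_ofReal_mul_I _

theorem e_eq_one_of_ofReal_mul_e_eq_one {r : ℝ} (hr : 0 < r) {q : ℚ} (h : (r : ℂ) * e q = 1) :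
    e q = 1 := by
  have r_eq_one : r = 1 := by
    simpa only [norm_mul, norm_e_ratCast, mul_one, Complex.norm_of_nonneg hr.le, norm_one]
      using congrArg norm h
  rwa [r_eq_one, Complex.ofReal_one, one_mul] at h

/-! ### Multiple series -/

theorem summable_norm_prod_and_hasSum_prod {R : Type*} [NormedCommRing R] [CompleteSpace R] {n : ℕ}
    {κ : Fin n → Type*} (f : ∀ i, κ i → R) (hf : ∀ i, Summable fun k ↦ ‖f i k‖) :
    (Summable fun k : ∀ i, κ i ↦ ‖∏ i, f i (k i)‖) ∧
      HasSum (fun k : ∀ i, κ i ↦ ∏ i, f i (k i)) (∏ i, ∑' k, f i k) := by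
  induction n with
  | zero => exact ⟨Summable.of_finite, by simp⟩
  | succ n ih =>
    obtain ⟨tail_summable, tail_hasSum⟩ := ih (fun i ↦ f i.succ) fun i ↦ hf _
    have prod_cons (p : κ 0 × ∀ i : Fin n, κ i.succ) :
        ∏ i, f i (Fin.consEquiv κ p i) = f 0 p.1 * ∏ i : Fin n, f i.succ (p.2 i) := by
      simp [Fin.consEquiv, Fin.prod_univ_succ]
    have norm_summable := Summable.mul_norm (hf 0) tail_summable
    have hasSum_mul := (hf 0).of_norm.hasSum.mul tail_hasSum norm_summable.of_norm
    rw [← (Fin.consEquiv κ).summable_iff, ← (Fin.consEquiv κ).hasSum_iff, Fin.prod_univ_succ]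
    simp only [Function.comp_def, prod_cons]
    exact ⟨norm_summable, hasSum_mul⟩

theorem eq_zero_of_hasSum_smul_orthonormal {𝕜 E ι : Type*} [RCLike 𝕜] [NormedAddCommGroup E]
    [InnerProductSpace 𝕜 E] {v : ι → E} (hv : Orthonormal 𝕜 v) {c : ι → 𝕜}
    (h : HasSum (fun i ↦ c i • v i) 0) : c = 0 := by
  classical
  ext k
  have inner_hasSum := (innerSL 𝕜 (v k)).hasSum h
  simp only [map_smul, map_zero, innerSL_apply_apply, orthonormal_iff_ite.1 hv, smul_eq_mul,
    mul_ite, mul_one, mul_zero, eq_comm (a := k)] at inner_hasSum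
  refine (hasSum_ite_eq k (c k)).unique ?_
  convert! inner_hasSum using 2 with j
  exact if_ctx_congr Iff.rfl (fun h ↦ by rw [h]) fun _ ↦ rfl

theorem eq_zero_of_hasSum_smul_mFourier {d : Type*} [Fintype d] {c : (d → ℤ) → ℂ}
    (h : HasSum (fun k ↦ c k • UnitAddTorus.mFourier k) 0) : c = 0 := by
  let : MeasureTheory.MeasureSpace UnitAddCircle := ⟨AddCircle.haarAddCircle⟩
  have : MeasureTheory.IsProbabilityMeasure
      (MeasureTheory.volume : MeasureTheory.Measure UnitAddCircle) :=
    inferInstanceAs (MeasureTheory.IsProbabilityMeasure AddCircle.haarAddCircle)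
  refine eq_zero_of_hasSum_smul_orthonormal (UnitAddTorus.orthonormal_mFourier (d := d)) ?_
  simpa only [map_smul, map_zero] using (ContinuousMap.toLp (E := ℂ) 2
    (MeasureTheory.volume : MeasureTheory.Measure (UnitAddTorus d)) ℂ).hasSum h

theorem eq_zero_of_tsum_mul_e_eq_zero {d : Type*} [Fintype d] {c : (d → ℤ) → ℂ}
    (hc : Summable fun k ↦ ‖c k‖)
    (h : ∀ x : d → ℝ, ∑' k, c k * e (∑ i, (k i : ℂ) * x i) = 0) : c = 0 := by
  have fourier_summable : Summable fun k : d → ℤ ↦ c k • UnitAddTorus.mFourier k :=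
    .of_norm <| by simpa only [norm_smul, UnitAddTorus.mFourier_norm, mul_one] using hc
  have fourier_tsum : ∑' k : d → ℤ, c k • UnitAddTorus.mFourier k = 0 := by
    ext y
    obtain ⟨x, rfl⟩ : ∃ x : d → ℝ, y = fun i ↦ (x i : UnitAddCircle) :=
      ⟨fun i ↦ (y i).out, by ext i; simp⟩
    rw [← ContinuousMap.tsum_apply fourier_summable]
    refine Eq.trans (tsum_congr fun k ↦ ?_) (h x)
    rw [e_sum]
    simp [UnitAddTorus.mFourier, e, mul_assoc, mul_left_comm]
  exact eq_zero_of_hasSum_smul_mFourier (fourier_tsum ▸ fourier_summable.hasSum)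

/-! ### One-dimensional theta series -/

/-- The summand `e(a t² τ / 2 + t ζ)` of a one-dimensional theta series; unlike
`jacobiTheta₂_term` it allows a non-integral `t`. -/
def gaussTerm (a : ℝ) (τ ζ t : ℂ) : ℂ := e (a * t ^ 2 / 2 * τ + t * ζ)

theorem gaussTerm_add_int (a : ℝ) (τ ζ t : ℂ) (k : ℤ) : gaussTerm a τ ζ (t + k) =
    gaussTerm a τ ζ t * jacobiTheta₂_term k (ζ + a * t * τ) (a * τ) := by
  rw [gaussTerm, gaussTerm, e, e, jacobiTheta₂_term, ← Complex.exp_add]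
  ring_nf

theorem gaussTerm_int_div {a : ℝ} (ha : a ≠ 0) (τ ζ : ℂ) (k : ℤ) : gaussTerm a τ ζ (k / a) =
    jacobiTheta₂_term k (ζ / a) (τ / a) := by
  have : (a : ℂ) ≠ 0 := by exact_mod_cast ha
  rw [gaussTerm, e, jacobiTheta₂_term]
  congr 1
  field_simp
  ring

theorem summable_norm_gaussTerm_add_int {a : ℝ} (ha : 0 < a) {τ : ℂ} (hτ : 0 < τ.im) (ζ t : ℂ) :
    Summable fun k : ℤ ↦ ‖gaussTerm a τ ζ (t + k)‖ := by
  simp only [gaussTerm_add_int]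
  refine (((summable_jacobiTheta₂_term_iff _ _).2 ?_).mul_left _).norm
  rw [Complex.im_ofReal_mul]
  positivity

theorem summable_norm_gaussTerm_int_div {a : ℝ} (ha : 0 < a) {τ : ℂ} (hτ : 0 < τ.im) (ζ : ℂ) :
    Summable fun k : ℤ ↦ ‖gaussTerm a τ ζ (k / a)‖ := by
  simp only [gaussTerm_int_div ha.ne']
  refine ((summable_jacobiTheta₂_term_iff _ _).2 ?_).norm
  rw [Complex.div_ofReal_im]
  positivity

/-- The holomorphic square root of `-i τ` with positive real part. -/
def sqrtNegI (τ : ℍ) : ℂ := (-Complex.I * τ) ^ (1 / 2 : ℂ)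

theorem cpow_half_div {a : ℝ} (ha : 0 < a) (τ : ℍ) :
    (-Complex.I * ((τ : ℂ) / a)) ^ (1 / 2 : ℂ) = (Real.sqrt a⁻¹ : ℂ) * sqrtNegI τ := by
  have ha' : 0 < a⁻¹ := inv_pos.2 ha
  have inv_ne_zero : ((a⁻¹ : ℝ) : ℂ) ≠ 0 := by exact_mod_cast ha'.ne'
  have negI_ne_zero : -Complex.I * (τ : ℂ) ≠ 0 :=
    mul_ne_zero (neg_ne_zero.2 Complex.I_ne_zero) τ.ne_zero
  rw [show -Complex.I * ((τ : ℂ) / a) = ((a⁻¹ : ℝ) : ℂ) * (-Complex.I * τ) by push_cast; ring,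
    Complex.cpow_def_of_ne_zero (mul_ne_zero inv_ne_zero negI_ne_zero),
    Complex.log_ofReal_mul ha' negI_ne_zero, add_mul, Complex.exp_add, sqrtNegI,
    Complex.cpow_def_of_ne_zero negI_ne_zero, Real.sqrt_eq_rpow, Complex.ofReal_cpow ha'.le,
    Complex.cpow_def_of_ne_zero inv_ne_zero, Complex.ofReal_log ha'.le]
  push_cast
  rfl

/-- This is `jacobiTheta₂_functional_equation` at `(ζ / a - t, τ / a)`, after completing the
square. -/
theorem tsum_gaussTerm_inversion {a : ℝ} (ha : 0 < a) (τ : ℍ) (ζ t : ℂ) :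
    (∑' k : ℤ, gaussTerm a (-1 / τ) (ζ / τ) (t + k)) * e (-(ζ ^ 2 / (2 * a * τ))) =
      √a⁻¹ * sqrtNegI τ * ∑' k : ℤ, e (-(k * t)) * gaussTerm a τ ζ (k / a) := by
  have ha' : (a : ℂ) ≠ 0 := by exact_mod_cast ha.ne'
  have hτ : (τ : ℂ) ≠ 0 := τ.ne_zero
  have dual_term (k : ℤ) : e (-(k * t)) * gaussTerm a τ ζ (k / a) =
      jacobiTheta₂_term k (ζ / a - t) (τ / a) := by
    rw [gaussTerm_int_div ha.ne', e, jacobiTheta₂_term, jacobiTheta₂_term, ← Complex.exp_add]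
    ring_nf
  have complete_square : gaussTerm a (-1 / τ) (ζ / τ) t * e (-(ζ ^ 2 / (2 * a * τ))) =
      Complex.exp (-Real.pi * Complex.I * (ζ / a - t) ^ 2 / (τ / a)) := by
    rw [gaussTerm, ← e_add, e]
    congr 1
    field_simp
    ring
  have argument_eq : (ζ / a - t) / (τ / a) = ζ / τ + a * t * (-1 / τ) := by field_simp; ring
  have modulus_eq : -1 / ((τ : ℂ) / a) = a * (-1 / τ) := by field_simp
  have root_ne_zero : (-Complex.I * ((τ : ℂ) / a)) ^ (1 / 2 : ℂ) ≠ 0 := by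
    simp [ha', hτ]
  simp only [dual_term, gaussTerm_add_int, tsum_mul_left, ← cpow_half_div ha]
  change _ * jacobiTheta₂ _ _ * _ = _ * jacobiTheta₂ _ _
  rw [jacobiTheta₂_functional_equation (ζ / a - t), argument_eq, modulus_eq, ← complete_square,
    ← mul_assoc, ← mul_assoc, mul_one_div_cancel root_ne_zero]
  ring

/-! ### Orthogonal families and quotients -/

theorem apply_sum_smul_of_iIsOrtho {R M ι : Type*} [CommRing R] [AddCommGroup M] [Module R M]
    [Fintype ι] {B : LinearMap.BilinForm R M} {b : ι → M} (orth : B.IsOrthoᵢ b) (c : ι → R)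
    (i : ι) : B (∑ j, c j • b j) (b i) = c i * B (b i) (b i) := by
  rw [map_sum, LinearMap.sum_apply, Finset.sum_eq_single i]
  · simp only [map_smul, LinearMap.smul_apply, smul_eq_mul]
  · intro j _ hji
    rw [map_smul, LinearMap.smul_apply, show B (b j) (b i) = 0 from orth hji, smul_zero]
  · simp

theorem eq_sum_smul_of_iIsOrtho {K V ι : Type*} [Field K] [AddCommGroup V] [Module K V] [Fintype ι]
    {B : LinearMap.BilinForm K V} {b : ι → V} (orth : B.IsOrthoᵢ b)
    (anisotropic : ∀ i, B (b i) (b i) ≠ 0) {r : V} (hr : r ∈ Submodule.span K (Set.range b)) :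
    r = ∑ i, (B r (b i) / B (b i) (b i)) • b i := by
  obtain ⟨c, rfl⟩ := (Submodule.mem_span_range_iff_exists_fun K).1 hr
  refine Finset.sum_congr rfl fun i _ ↦ ?_
  rw [apply_sum_smul_of_iIsOrtho orth, mul_div_cancel_right₀ _ (anisotropic i)]

theorem sum_out_eq_ite {G R : Type*} [AddCommGroup G] [CommRing R] [IsDomain R] (H : AddSubgroup G)
    [Fintype (G ⧸ H)] (ψ : AddChar G R) [Decidable (ψ = 1)] (hψ : ∀ x ∈ H, ψ x = 1) :
    ∑ q : G ⧸ H, ψ q.out = if ψ = 1 then (Fintype.card (G ⧸ H) : R) else 0 := by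
  classical
  let φ : AddChar (G ⧸ H) R := AddChar.toAddMonoidHomEquiv.symm
    (QuotientAddGroup.lift H ψ.toAddMonoidHom fun x hx ↦ hψ x hx)
  have φ_mk (x : G) : φ x = ψ x := rfl
  have φ_eq_zero_iff : φ = 0 ↔ ψ = 1 := by
    rw [AddChar.eq_zero_iff, AddChar.eq_one_iff]
    exact ⟨fun h x ↦ h x, fun h q ↦ QuotientAddGroup.induction_on q h⟩
  have φ_apply (q : G ⧸ H) : ψ q.out = φ q := by rw [← φ_mk, QuotientAddGroup.out_eq']
  simp only [φ_apply, AddChar.sum_eq_ite, φ_eq_zero_iff]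

/-- A subgroup `H` and a choice of representatives decompose `G` as a product. -/
def quotientProdEquiv {G : Type*} [AddGroup G] (H : AddSubgroup G) : (G ⧸ H) × H ≃ G :=
  Equiv.ofBijective (fun p ↦ p.1.out + p.2) <| by
    constructor
    · rintro ⟨p, x⟩ ⟨q, y⟩ h
      have class_eq : p = q := by
        simpa using congrArg (QuotientAddGroup.mk (s := H)) h
      subst class_eq
      simpa using h
    · intro g
      obtain ⟨x, hx⟩ := QuotientAddGroup.mk_out_eq_add H g
      exact ⟨(g, -x), by simp [hx]⟩

namespace IntegralLattice

variable (L : IntegralLattice.{u})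

/-! ### The rational and complex spans of a lattice -/

@[simp] theorem toRat_zero : L.toRat 0 = 0 := TensorProduct.tmul_zero _ _

@[simp] theorem toRat_add (x y : L) : L.toRat (x + y) = L.toRat x + L.toRat y :=
  TensorProduct.tmul_add _ _ _

@[simp] theorem toRat_zsmul (m : ℤ) (x : L) : L.toRat (m • x) = (m : ℚ) • L.toRat x := by
  rw [toRat, toRat, TensorProduct.tmul_smul, Int.cast_smul_eq_zsmul]

theorem toRat_sum {ι : Type*} (s : Finset ι) (f : ι → L) :
    L.toRat (∑ i ∈ s, f i) = ∑ i ∈ s, L.toRat (f i) :=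
  TensorProduct.tmul_sum _ _ _

theorem toRat_injective : Function.Injective L.toRat := fun x y h ↦ by
  obtain ⟨m, hm⟩ := (IsLocalizedModule.eq_iff_exists (nonZeroDivisors ℤ)
    (TensorProduct.mk ℤ ℚ L 1)).1 h
  exact smul_right_injective L (nonZeroDivisors.ne_zero m.2) hm

theorem exists_smul_eq_toRat (r : L.RatSpace) :
    ∃ (m : ℤ) (x : L), m ≠ 0 ∧ (m : ℚ) • r = L.toRat x := by
  obtain ⟨⟨x, m⟩, h⟩ := IsLocalizedModule.surj (nonZeroDivisors ℤ) (TensorProduct.mk ℤ ℚ L 1) r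
  exact ⟨m, x, nonZeroDivisors.ne_zero m.2, by rw [Int.cast_smul_eq_zsmul]; exact h⟩

@[simp] theorem formQ_toRat (x y : L) : L.formQ (L.toRat x) (L.toRat y) = L.form x y := by
  simp [toRat]

theorem formQ_isSymm : LinearMap.IsSymm L.formQ :=
  LinearMap.BilinForm.IsSymm.baseChange ℚ ⟨L.symm⟩

theorem formQ_symm (r s : L.RatSpace) : L.formQ r s = L.formQ s r :=
  L.formQ_isSymm.eq r s

theorem formC_symm (z w : L.CplxSpace) : L.formC z w = L.formC w z :=
  (LinearMap.BilinForm.IsSymm.baseChange ℂ ⟨L.symm⟩).eq z w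

@[simp] theorem toCplx_tmul (q : ℚ) (x : L) : L.toCplx (q ⊗ₜ x) = (q : ℂ) ⊗ₜ x := rfl

theorem toCplx_smul (q : ℚ) (r : L.RatSpace) : L.toCplx (q • r) = (q : ℂ) • L.toCplx r := by
  induction r using TensorProduct.induction_on with
  | zero => simp
  | add a b ha hb => simp only [smul_add, map_add, ha, hb]
  | tmul p x => simp [TensorProduct.smul_tmul']

@[simp] theorem toCplx_toRat (x : L) : L.toCplx (L.toRat x) = 1 ⊗ₜ x := by
  rw [toRat, toCplx_tmul, Rat.cast_one]

/-! ### The shadow -/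

/-- The character `x ↦ e(β(x, x) / 2)`, with values `± 1`. -/
def signChar : AddChar L ℂ where
  toFun x := e ((L.form x x : ℂ) / 2)
  map_zero_eq_one' := by simp [e_zero]
  map_add_eq_mul' x y := by
    rw [← e_add]
    refine e_eq_of_sub_eq_intCast (m := L.form x y) ?_
    simp only [map_add, LinearMap.add_apply, L.symm y x]
    push_cast
    ring

theorem signChar_apply (x : L) : L.signChar x = e ((L.form x x : ℂ) / 2) := rfl

theorem signChar_mul_self (x : L) : L.signChar x * L.signChar x = 1 := by
  rw [signChar_apply, ← e_add, add_halves, e_intCast]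

theorem signChar_of_even {x : L} (hx : Even x) : L.signChar x = 1 := by
  obtain ⟨y, rfl⟩ := hx
  rw [AddChar.map_add_eq_mul, signChar_mul_self]

theorem norm_signChar (x : L) : ‖L.signChar x‖ = 1 := by
  have norm_sq : ‖L.signChar x‖ * ‖L.signChar x‖ = 1 := by
    rw [← norm_mul, signChar_mul_self, norm_one]
  nlinarith [norm_nonneg (L.signChar x)]

/-- The character `x ↦ e(β(x, x) / 2 - β(r, x))`, which is trivial exactly for `r` in the
shadow. -/
def shadowChar (r : L.RatSpace) : AddChar L ℂ where
  toFun x := L.signChar x * e (-L.formQ r (L.toRat x))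
  map_zero_eq_one' := by simp [e_zero]
  map_add_eq_mul' x y := by
    rw [AddChar.map_add_eq_mul, toRat_add, map_add, Rat.cast_add, neg_add, e_add]
    ring

theorem shadowChar_apply (r : L.RatSpace) (x : L) :
    L.shadowChar r x = L.signChar x * e (-L.formQ r (L.toRat x)) := rfl

theorem shadowChar_apply_eq_one_iff (r : L.RatSpace) (x : L) : L.shadowChar r x = 1 ↔
    ∃ m : ℤ, L.formQ r (L.toRat x) - (L.form x x : ℚ) / 2 = m := by
  rw [shadowChar_apply, signChar_apply, e_neg, ← div_eq_mul_inv, ← e_sub, ← inv_eq_one, ← e_neg,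
    neg_sub, e_eq_one_iff]
  refine exists_congr fun m ↦ ?_
  rw [← @Rat.cast_inj ℂ]
  push_cast
  rfl

theorem mem_shadow_iff (r : L.RatSpace) : r ∈ L.shadow ↔ L.shadowChar r = 1 := by
  rw [AddChar.eq_one_iff]
  exact forall_congr' fun x ↦ (L.shadowChar_apply_eq_one_iff r x).symm

variable {L}

theorem e_neg_formQ_toRat (r : L.shadow) (x : L) :
    e (-L.formQ r (L.toRat x)) = L.signChar x := by
  have char_eq_one : L.signChar x * e (-L.formQ r (L.toRat x)) = 1 :=
    DFunLike.congr_fun ((L.mem_shadow_iff _).1 r.2) x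
  rw [← mul_one (L.signChar x), ← char_eq_one, ← mul_assoc, signChar_mul_self, one_mul]

theorem add_toRat_mem_shadow {r : L.RatSpace} (hr : r ∈ L.shadow) (x : L) :
    r + L.toRat x ∈ L.shadow := by
  intro y
  obtain ⟨m, hm⟩ := hr y
  refine ⟨m + L.form x y, ?_⟩
  rw [map_add, LinearMap.add_apply, formQ_toRat]
  push_cast
  rw [← hm]
  ring

instance : VAdd L L.shadow := ⟨fun x r ↦ ⟨r + L.toRat x, add_toRat_mem_shadow r.2 x⟩⟩

@[simp] theorem coe_vadd_shadow (x : L) (r : L.shadow) :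
    ((x +ᵥ r : L.shadow) : L.RatSpace) = r + L.toRat x := rfl

instance : AddAction L L.shadow where
  zero_vadd r := by ext; simp
  add_vadd x y r := by ext; simp only [coe_vadd_shadow, toRat_add]; abel

theorem vadd_shadow_right_cancel {x y : L} {r : L.shadow} (h : x +ᵥ r = y +ᵥ r) : x = y :=
  L.toRat_injective (add_left_cancel (congrArg Subtype.val h))

theorem e_neg_formQ_vadd (r s : L.shadow) (x : L) :
    e (-L.formQ r (x +ᵥ s : L.shadow)) = L.signChar x * e (-L.formQ r s) := by
  rw [coe_vadd_shadow, map_add, Rat.cast_add, neg_add, e_add, e_neg_formQ_toRat, mul_comm]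

theorem mem_W_iff {l : L.shadow → ℂ} :
    l ∈ L.W ↔ ∀ (x : L) (r : L.shadow), l (x +ᵥ r) = L.signChar x * l r :=
  ⟨fun hl x r ↦ hl r (x +ᵥ r) x rfl, fun hl r _ x h ↦ by
    obtain rfl := Subtype.ext (h.trans (coe_vadd_shadow x r).symm)
    exact hl x r⟩

theorem W_apply_vadd {l : L.shadow → ℂ} (hl : l ∈ L.W) (x : L) (r : L.shadow) :
    l (x +ᵥ r) = L.signChar x * l r :=
  mem_W_iff.1 hl x r

theorem norm_e_neg_formQ (r s : L.RatSpace) : ‖e (-L.formQ r s)‖ = 1 :=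
  Rat.cast_neg (α := ℂ) _ ▸ norm_e_ratCast _

variable (L) in
/-- The set of cosets of the lattice in its shadow. -/
abbrev ShadowQuot : Type u := Quotient (AddAction.orbitRel L L.shadow)

variable (L) in
/-- A choice of representatives of the cosets decomposes the shadow as a product. -/
def shadowEquiv : L.ShadowQuot × L ≃ L.shadow :=
  Equiv.ofBijective (fun p ↦ p.2 +ᵥ p.1.out) <| by
    constructor
    · rintro ⟨p, x⟩ ⟨q, y⟩ h
      change x +ᵥ p.out = y +ᵥ q.out at h
      have class_eq : p = q := by
        rw [← Quotient.out_eq p, ← Quotient.out_eq q]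
        exact Quotient.sound ⟨-x + y, by simp only [← vadd_vadd, ← h, neg_vadd_vadd]⟩
      subst class_eq
      rw [vadd_shadow_right_cancel h]
    · intro s
      obtain ⟨x, hx⟩ := (AddAction.orbitRel L L.shadow).symm (Quotient.mk_out s)
      exact ⟨(⟦s⟧, x), hx⟩

@[simp] theorem shadowEquiv_apply (p : L.ShadowQuot × L) : L.shadowEquiv p = p.2 +ᵥ p.1.out := rfl

/-! ### Orthogonal frames -/

variable (L) in
/-- An orthogonal basis of `ℚ ⊗ L` consisting of vectors in `2 L` of positive length. The theta
series of `L` split into products of one-dimensional ones along it, and on its `ℤ`-span the sign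
character is trivial. -/
structure OrthFrame where
  vec : Fin L.rank → L
  orth : ∀ i j, i ≠ j → L.form (vec i) (vec j) = 0
  pos : ∀ i, 0 < L.form (vec i) (vec i)
  even : ∀ i, Even (vec i)
  span_eq_top : Submodule.span ℚ (Set.range fun i ↦ L.toRat (vec i)) = ⊤

theorem IsPosDef.nonempty_orthFrame (h : L.IsPosDef) : Nonempty L.OrthFrame := by
  obtain ⟨b, orth⟩ : ∃ b : Module.Basis (Fin L.rank) ℚ L.RatSpace, L.formQ.IsOrthoᵢ b := by
    rw [rank, ← Module.finrank_baseChange (R := ℚ)]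
    exact LinearMap.BilinForm.exists_orthogonal_basis L.formQ_isSymm
  choose m x m_ne_zero hx using fun i ↦ L.exists_smul_eq_toRat (b i)
  have scale_ne_zero (i) : (2 * m i : ℚ) ≠ 0 :=
    mul_ne_zero two_ne_zero (Int.cast_ne_zero.2 (m_ne_zero i))
  have toRat_vec (i) : L.toRat (x i + x i) = (2 * m i : ℚ) • b i := by
    rw [toRat_add, ← hx, ← two_smul ℚ, smul_smul]
  refine ⟨⟨fun i ↦ x i + x i, fun i j hij ↦ ?_, fun i ↦ h _ fun h0 ↦ ?_, fun i ↦ ⟨x i, rfl⟩, ?_⟩⟩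
  · rw [← Int.cast_inj (α := ℚ), ← formQ_toRat, toRat_vec, toRat_vec, map_smul, map_smul,
      LinearMap.smul_apply, show L.formQ (b i) (b j) = 0 from orth hij, smul_zero, smul_zero,
      Int.cast_zero]
  · rw [← L.toRat_injective.eq_iff, toRat_vec, toRat_zero] at h0
    exact smul_ne_zero (scale_ne_zero i) (b.ne_zero i) h0
  · simp only [toRat_vec, ← b.isUnitSMul_apply fun i ↦ (scale_ne_zero i).isUnit]
    exact Module.Basis.span_eq _

end IntegralLattice

namespace IntegralLattice

variable {L : IntegralLattice.{u}}

variable (L) in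
/-- The summand `e(τ β(r, r) / 2) e(β(r, z))` of a theta series. -/
def thetaTerm (τ : ℂ) (z : L.CplxSpace) (r : L.RatSpace) : ℂ :=
  e ((L.formQ r r / 2 : ℚ) * τ) * e (L.formC (L.toCplx r) z)

namespace OrthFrame

variable (F : L.OrthFrame)

/-- The squared lengths of the vectors of the frame. -/
def len (i : Fin L.rank) : ℤ := L.form (F.vec i) (F.vec i)

theorem len_pos (i : Fin L.rank) : 0 < F.len i := F.pos i

theorem len_ne_zero (K : Type*) [DivisionRing K] [CharZero K] (i : Fin L.rank) :
    (F.len i : K) ≠ 0 :=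
  Int.cast_ne_zero.2 (F.len_pos i).ne'

theorem formQ_vec_self (i : Fin L.rank) :
    L.formQ (L.toRat (F.vec i)) (L.toRat (F.vec i)) = F.len i :=
  L.formQ_toRat _ _

theorem isOrtho_toRat_vec : L.formQ.IsOrthoᵢ fun i ↦ L.toRat (F.vec i) := fun i j hij ↦ by
  change L.formQ _ _ = 0
  rw [formQ_toRat, F.orth i j hij, Int.cast_zero]

/-- The vector with given rational coordinates with respect to the frame. -/
def pt : (Fin L.rank → ℚ) →ₗ[ℚ] L.RatSpace :=
  Fintype.linearCombination ℚ fun i ↦ L.toRat (F.vec i)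

theorem pt_apply (t : Fin L.rank → ℚ) : F.pt t = ∑ i, t i • L.toRat (F.vec i) := rfl

/-- The coordinates of a rational vector with respect to the frame. -/
def coord (r : L.RatSpace) (i : Fin L.rank) : ℚ := L.formQ r (L.toRat (F.vec i)) / F.len i

theorem pt_coord (r : L.RatSpace) : F.pt (F.coord r) = r := by
  have expansion := eq_sum_smul_of_iIsOrtho F.isOrtho_toRat_vec
    (fun i ↦ F.formQ_vec_self i ▸ F.len_ne_zero ℚ i)
    (show r ∈ Submodule.span ℚ _ from F.span_eq_top ▸ Submodule.mem_top)
  simp only [formQ_vec_self] at expansion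
  exact expansion.symm

theorem formQ_pt_vec (t : Fin L.rank → ℚ) (i : Fin L.rank) :
    L.formQ (F.pt t) (L.toRat (F.vec i)) = t i * F.len i := by
  rw [pt_apply, apply_sum_smul_of_iIsOrtho F.isOrtho_toRat_vec, formQ_vec_self]

theorem pt_injective : Function.Injective F.pt := fun s t h ↦ by
  ext i
  refine mul_right_cancel₀ (F.len_ne_zero ℚ i) ?_
  rw [← formQ_pt_vec, h, formQ_pt_vec]

theorem formQ_pt (r : L.RatSpace) (t : Fin L.rank → ℚ) :
    L.formQ r (F.pt t) = ∑ i, t i * L.formQ r (L.toRat (F.vec i)) := by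
  simp only [pt_apply, map_sum, map_smul, smul_eq_mul]

theorem formQ_pt_self (t : Fin L.rank → ℚ) :
    L.formQ (F.pt t) (F.pt t) = ∑ i, F.len i * t i ^ 2 := by
  rw [formQ_pt]
  refine Finset.sum_congr rfl fun i _ ↦ ?_
  rw [formQ_pt_vec]
  ring

/-- The vector whose products with the vectors of the frame are the given integers. -/
def dualPt (k : Fin L.rank → ℤ) : L.RatSpace := F.pt fun i ↦ k i / F.len i

theorem formQ_dualPt_vec (k : Fin L.rank → ℤ) (i : Fin L.rank) :
    L.formQ (F.dualPt k) (L.toRat (F.vec i)) = k i := by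
  rw [dualPt, formQ_pt_vec, div_mul_cancel₀ _ (F.len_ne_zero ℚ i)]

theorem formQ_dualPt (r : L.RatSpace) (k : Fin L.rank → ℤ) :
    L.formQ r (F.dualPt k) = ∑ i, k i * F.coord r i := by
  rw [dualPt, formQ_pt]
  exact Finset.sum_congr rfl fun i _ ↦ by rw [coord, div_mul_eq_mul_div, mul_div_assoc]

/-! ### Integral combinations of a frame -/

/-- The integral combinations of the vectors of the frame. -/
def comb : (Fin L.rank → ℤ) →ₗ[ℤ] L := Fintype.linearCombination ℤ F.vec

theorem toRat_comb (k : Fin L.rank → ℤ) : L.toRat (F.comb k) = F.pt fun i ↦ (k i : ℚ) := by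
  simp only [comb, Fintype.linearCombination_apply, toRat_sum, toRat_zsmul, pt_apply]

theorem comb_injective : Function.Injective F.comb := fun k l h ↦ by
  have pt_eq := congrArg L.toRat h
  rw [toRat_comb, toRat_comb] at pt_eq
  ext i
  exact_mod_cast congrFun (F.pt_injective pt_eq) i

theorem signChar_comb (k : Fin L.rank → ℤ) : L.signChar (F.comb k) = 1 :=
  L.signChar_of_even (x := ∑ i, k i • F.vec i) <|
    Finset.even_sum _ fun i _ ↦ (F.even i).zsmul_right _

theorem shadowChar_dualPt_comb (k l : Fin L.rank → ℤ) :
    L.shadowChar (F.dualPt k) (F.comb l) = 1 := by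
  have integral : L.formQ (F.dualPt k) (L.toRat (F.comb l)) = (∑ i, l i * k i : ℤ) := by
    simp only [toRat_comb, formQ_pt, formQ_dualPt_vec, Int.cast_sum, Int.cast_mul]
  rw [shadowChar_apply, signChar_comb, one_mul, integral, Rat.cast_intCast, e_neg, e_intCast,
    inv_one]

/-- The sublattice spanned by the frame. -/
def sublattice : AddSubgroup L := (LinearMap.range F.comb).toAddSubgroup

instance : Finite (L ⧸ F.sublattice) :=
  Submodule.finiteQuotientOfFreeOfRankEq (LinearMap.range F.comb) <| by
    rw [LinearMap.finrank_range_of_inj F.comb_injective, Module.finrank_fin_fun, rank]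

/-- The decomposition of the lattice into cosets of the sublattice spanned by the frame, with
integral coordinates in each coset. -/
def cosetEquiv : (L ⧸ F.sublattice) × (Fin L.rank → ℤ) ≃ L :=
  ((Equiv.refl _).prodCongr (LinearEquiv.ofInjective F.comb F.comb_injective).toEquiv).trans
    (quotientProdEquiv F.sublattice)

theorem cosetEquiv_apply (p : (L ⧸ F.sublattice) × (Fin L.rank → ℤ)) :
    F.cosetEquiv p = p.1.out + F.comb p.2 := rfl

theorem sum_shadowChar_dualPt [Fintype (L ⧸ F.sublattice)] (k : Fin L.rank → ℤ)
    [Decidable (F.dualPt k ∈ L.shadow)] :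
    ∑ q : L ⧸ F.sublattice, L.shadowChar (F.dualPt k) q.out =
      if F.dualPt k ∈ L.shadow then (Nat.card (L ⧸ F.sublattice) : ℂ) else 0 := by
  classical
  rw [sum_out_eq_ite F.sublattice, Nat.card_eq_fintype_card]
  · simp only [mem_shadow_iff]
  · rintro _ ⟨l, rfl⟩
    exact F.shadowChar_dualPt_comb k l

/-! ### Integral coordinates on the shadow -/

theorem exists_int_formQ_vec (r : L.shadow) (i : Fin L.rank) :
    ∃ m : ℤ, L.formQ r (L.toRat (F.vec i)) = m := by
  obtain ⟨x, hx⟩ := F.even i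
  obtain ⟨m, hm⟩ := r.2 x
  refine ⟨2 * m + L.form x x, ?_⟩
  rw [hx, toRat_add, map_add]
  push_cast
  rw [← hm]
  ring

/-- The products of an element of the shadow with the vectors of the frame. -/
def intCoord (r : L.shadow) (i : Fin L.rank) : ℤ := (F.exists_int_formQ_vec r i).choose

theorem formQ_vec_eq_intCoord (r : L.shadow) (i : Fin L.rank) :
    L.formQ r (L.toRat (F.vec i)) = F.intCoord r i := (F.exists_int_formQ_vec r i).choose_spec

theorem dualPt_intCoord (r : L.shadow) : F.dualPt (F.intCoord r) = r := by
  simp only [dualPt, ← formQ_vec_eq_intCoord]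
  exact F.pt_coord r

theorem intCoord_injective : Function.Injective F.intCoord := fun r s h ↦ by
  ext
  rw [← F.dualPt_intCoord r, h, F.dualPt_intCoord]

theorem intCoord_dualPt {k : Fin L.rank → ℤ} (hk : F.dualPt k ∈ L.shadow) :
    F.intCoord ⟨F.dualPt k, hk⟩ = k := by
  ext i
  rw [← Int.cast_inj (α := ℚ), ← formQ_vec_eq_intCoord, formQ_dualPt_vec]

theorem tsum_ite_dualPt_mem_shadow {R : Type*} [AddCommMonoid R] [TopologicalSpace R]
    [∀ k, Decidable (F.dualPt k ∈ L.shadow)] (f : L.RatSpace → R) :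
    ∑' k, (if F.dualPt k ∈ L.shadow then f (F.dualPt k) else 0) = ∑' s : L.shadow, f s := by
  rw [← F.intCoord_injective.tsum_eq]
  · refine tsum_congr fun s ↦ ?_
    rw [if_pos (F.dualPt_intCoord s ▸ s.2), dualPt_intCoord]
  · intro k hk
    have mem : F.dualPt k ∈ L.shadow := by
      by_contra not_mem
      exact hk (if_neg not_mem)
    exact ⟨⟨_, mem⟩, F.intCoord_dualPt mem⟩

theorem exists_comb_of_dvd {r s : L.shadow} (h : ∀ i, F.len i ∣ F.intCoord s i - F.intCoord r i) :
    ∃ k, F.comb k +ᵥ r = s := by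
  choose k hk using h
  refine ⟨k, ?_⟩
  ext
  rw [coe_vadd_shadow, toRat_comb, ← F.dualPt_intCoord r, ← F.dualPt_intCoord s, dualPt, dualPt,
    ← map_add]
  congr 1
  ext i
  rw [Pi.add_apply, div_add' _ _ _ (F.len_ne_zero ℚ i), ← sub_add_cancel (F.intCoord s i), hk]
  push_cast
  ring

theorem finite_shadowQuot (F : L.OrthFrame) : Finite L.ShadowQuot := by
  have (i : Fin L.rank) : NeZero (F.len i).natAbs := ⟨Int.natAbs_ne_zero.2 (F.len_pos i).ne'⟩
  refine Finite.of_injective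
    (fun (q : L.ShadowQuot) (i : Fin L.rank) ↦ (F.intCoord q.out i : ZMod (F.len i).natAbs))
    fun p q h ↦ ?_
  obtain ⟨k, hk⟩ := F.exists_comb_of_dvd (r := q.out) (s := p.out) fun i ↦
    Int.natAbs_dvd.1 <| (ZMod.intCast_eq_intCast_iff_dvd_sub _ _ _).1 (congrFun h i).symm
  rw [← Quotient.out_eq p, ← Quotient.out_eq q]
  exact Quotient.sound ⟨F.comb k, hk⟩

end OrthFrame

end IntegralLattice

theorem im_neg_one_div_pos (τ : ℍ) : 0 < (-1 / (τ : ℂ)).im := by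
  simpa only [neg_div, one_div, inv_neg] using τ.im_inv_neg_coe_pos

namespace IntegralLattice

variable {L : IntegralLattice.{u}}

namespace OrthFrame

variable (F : L.OrthFrame)

/-! ### Splitting of theta series along a frame -/

/-- The products of a complex vector with the vectors of the frame. -/
def zeta (z : L.CplxSpace) (i : Fin L.rank) : ℂ := L.formC (1 ⊗ₜ F.vec i) z

theorem zeta_smul (c : ℂ) (z : L.CplxSpace) (i : Fin L.rank) :
    F.zeta (c • z) i = c * F.zeta z i := by
  simp only [zeta, map_smul, smul_eq_mul]

theorem isOrtho_tmul_vec :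
    L.formC.IsOrthoᵢ fun i ↦ ((1 : ℂ) ⊗ₜ[ℤ] F.vec i : L.CplxSpace) := fun i j hij ↦ by
  change L.formC _ _ = 0
  simp [F.orth i j hij]

theorem formC_vec_self (i : Fin L.rank) :
    L.formC (1 ⊗ₜ F.vec i) (1 ⊗ₜ F.vec i) = F.len i := by
  simp [len]

theorem toCplx_pt (t : Fin L.rank → ℚ) :
    L.toCplx (F.pt t) = ∑ i, (t i : ℂ) • ((1 : ℂ) ⊗ₜ[ℤ] F.vec i : L.CplxSpace) := by
  simp only [pt_apply, map_sum, toCplx_smul, toCplx_toRat]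

theorem span_tmul_vec_eq_top :
    Submodule.span ℂ (Set.range fun i ↦ ((1 : ℂ) ⊗ₜ[ℤ] F.vec i : L.CplxSpace)) = ⊤ := by
  refine eq_top_iff.2 fun z _ ↦ ?_
  induction z using TensorProduct.induction_on with
  | zero => exact zero_mem _
  | add a b ha hb => exact add_mem (ha trivial) (hb trivial)
  | tmul c x =>
    have tmul_eq : (c ⊗ₜ x : L.CplxSpace) = c • L.toCplx (L.toRat x) := by
      rw [toCplx_toRat, TensorProduct.smul_tmul', smul_eq_mul, mul_one]
    rw [tmul_eq, ← F.pt_coord (L.toRat x), toCplx_pt]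
    exact Submodule.smul_mem _ _ <| Submodule.sum_mem _ fun i _ ↦
      Submodule.smul_mem _ _ <| Submodule.subset_span ⟨i, rfl⟩

theorem formC_self (z : L.CplxSpace) : L.formC z z = ∑ i, F.zeta z i ^ 2 / F.len i := by
  have expansion := eq_sum_smul_of_iIsOrtho F.isOrtho_tmul_vec
    (fun i ↦ F.formC_vec_self i ▸ F.len_ne_zero ℂ i)
    (show z ∈ Submodule.span ℂ _ from F.span_tmul_vec_eq_top ▸ Submodule.mem_top)
  simp only [formC_vec_self] at expansion
  conv_lhs => enter [1]; rw [expansion]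
  simp only [map_sum, LinearMap.sum_apply, map_smul, LinearMap.smul_apply, smul_eq_mul]
  refine Finset.sum_congr rfl fun i _ ↦ ?_
  rw [L.formC_symm z, ← zeta]
  ring

theorem zeta_surjective : Function.Surjective F.zeta := fun c ↦ by
  refine ⟨∑ i, (c i / F.len i) • ((1 : ℂ) ⊗ₜ[ℤ] F.vec i : L.CplxSpace), ?_⟩
  ext i
  rw [zeta, L.formC_symm, apply_sum_smul_of_iIsOrtho F.isOrtho_tmul_vec, formC_vec_self,
    div_mul_cancel₀ _ (F.len_ne_zero ℂ i)]

theorem formC_toCplx_pt (t : Fin L.rank → ℚ) (z : L.CplxSpace) :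
    L.formC (L.toCplx (F.pt t)) z = ∑ i, t i * F.zeta z i := by
  simp only [toCplx_pt, map_sum, LinearMap.sum_apply, map_smul, LinearMap.smul_apply, smul_eq_mul,
    zeta]

theorem thetaTerm_pt (τ : ℂ) (z : L.CplxSpace) (t : Fin L.rank → ℚ) :
    L.thetaTerm τ z (F.pt t) = ∏ i, gaussTerm (F.len i) τ (F.zeta z i) (t i) := by
  simp only [gaussTerm]
  rw [thetaTerm, formC_toCplx_pt, formQ_pt_self, ← e_add, ← e_sum, Finset.sum_add_distrib]
  push_cast
  rw [Finset.sum_div, Finset.sum_mul]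

theorem thetaTerm_dualPt (τ : ℂ) (z : L.CplxSpace) (k : Fin L.rank → ℤ) :
    L.thetaTerm τ z (F.dualPt k) =
      ∏ i, gaussTerm (F.len i) τ (F.zeta z i) (k i / (F.len i : ℝ)) := by
  rw [dualPt, thetaTerm_pt]
  push_cast
  rfl

theorem thetaTerm_add_comb (τ : ℂ) (z : L.CplxSpace) (r : L.RatSpace) (k : Fin L.rank → ℤ) :
    L.thetaTerm τ z (r + L.toRat (F.comb k)) =
      ∏ i, gaussTerm (F.len i) τ (F.zeta z i) (F.coord r i + k i) := by
  conv_lhs => rw [← F.pt_coord r, toRat_comb, ← map_add, thetaTerm_pt]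
  simp only [Pi.add_apply, Rat.cast_add, Rat.cast_intCast]

theorem summable_thetaTerm_dualPt (τ : ℍ) (z : L.CplxSpace) :
    Summable fun k : Fin L.rank → ℤ ↦ ‖L.thetaTerm τ z (F.dualPt k)‖ := by
  simp only [thetaTerm_dualPt]
  exact (summable_norm_prod_and_hasSum_prod
    (fun i (k : ℤ) ↦ gaussTerm (F.len i) τ (F.zeta z i) (k / (F.len i : ℝ)))
    fun i ↦ summable_norm_gaussTerm_int_div (Int.cast_pos.2 (F.len_pos i)) τ.im_pos _).1

theorem summable_thetaTerm (F : L.OrthFrame) (τ : ℍ) (z : L.CplxSpace) :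
    Summable fun r : L.shadow ↦ ‖L.thetaTerm τ z r‖ := by
  refine ((F.summable_thetaTerm_dualPt τ z).comp_injective F.intCoord_injective).congr fun r ↦ ?_
  rw [Function.comp_apply, dualPt_intCoord]

theorem tsum_thetaTerm_add_comb (τ : ℍ) (z : L.CplxSpace) (r : L.RatSpace) :
    ∑' k : Fin L.rank → ℤ, L.thetaTerm τ z (r + L.toRat (F.comb k)) =
      ∏ i, ∑' k : ℤ, gaussTerm (F.len i) τ (F.zeta z i) (F.coord r i + k) := by
  simp only [thetaTerm_add_comb]
  exact (summable_norm_prod_and_hasSum_prod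
    (fun i (k : ℤ) ↦ gaussTerm (F.len i) τ (F.zeta z i) (F.coord r i + k)) fun i ↦
      summable_norm_gaussTerm_add_int (Int.cast_pos.2 (F.len_pos i)) τ.im_pos _ _).2.tsum_eq

theorem tsum_thetaTerm_dualPt (τ : ℍ) (z : L.CplxSpace) (r : L.RatSpace) :
    ∑' k : Fin L.rank → ℤ, e (-L.formQ r (F.dualPt k)) * L.thetaTerm τ z (F.dualPt k) =
      ∏ i, ∑' k : ℤ, e (-(k * F.coord r i)) *
        gaussTerm (F.len i) τ (F.zeta z i) (k / (F.len i : ℝ)) := by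
  have term_eq (k : Fin L.rank → ℤ) :
      e (-L.formQ r (F.dualPt k)) * L.thetaTerm τ z (F.dualPt k) =
        ∏ i, (e (-(k i * F.coord r i)) *
          gaussTerm (F.len i) τ (F.zeta z i) (k i / (F.len i : ℝ))) := by
    rw [Finset.prod_mul_distrib, ← e_sum, Finset.sum_neg_distrib, thetaTerm_dualPt, formQ_dualPt]
    push_cast
    rfl
  rw [tsum_congr term_eq]
  refine (summable_norm_prod_and_hasSum_prod (fun i (k : ℤ) ↦ e (-(k * F.coord r i)) *
    gaussTerm (F.len i) τ (F.zeta z i) (k / (F.len i : ℝ))) fun i ↦ ?_).2.tsum_eq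
  refine (summable_norm_gaussTerm_int_div (Int.cast_pos.2 (F.len_pos i)) τ.im_pos
    (F.zeta z i)).congr fun k ↦ ?_
  rw [norm_mul, show (-(k * F.coord r i) : ℂ) = ((-(k * F.coord r i) : ℚ) : ℂ) by push_cast; rfl,
    norm_e_ratCast, one_mul]

/-! ### Inversion of theta series -/

theorem tsum_thetaTerm_inversion (τ : ℍ) (z : L.CplxSpace) (r : L.RatSpace) :
    (∑' k, L.thetaTerm (-1 / τ) ((τ : ℂ)⁻¹ • z) (r + L.toRat (F.comb k))) *
        e (-(L.formC z z / 2) / τ) =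
      (∏ i, √(F.len i : ℝ)⁻¹ : ℝ) * sqrtNegI τ ^ L.rank *
        ∑' k, e (-L.formQ r (F.dualPt k)) * L.thetaTerm τ z (F.dualPt k) := by
  have gaussian_factor : e (-(L.formC z z / 2) / τ) =
      ∏ i, e (-(F.zeta z i ^ 2 / (2 * (F.len i : ℝ) * τ))) := by
    rw [← e_sum, F.formC_self, Finset.sum_neg_distrib, neg_div, Finset.sum_div, Finset.sum_div]
    congr 2
    refine Finset.sum_congr rfl fun i _ ↦ ?_
    push_cast
    field_simp
  have constant_factor : ((∏ i, √(F.len i : ℝ)⁻¹ : ℝ) : ℂ) * sqrtNegI τ ^ L.rank =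
      ∏ i, √(F.len i : ℝ)⁻¹ * sqrtNegI τ := by
    rw [Finset.prod_mul_distrib, Finset.prod_const, Finset.card_univ, Fintype.card_fin,
      Complex.ofReal_prod]
  have product_formula := F.tsum_thetaTerm_add_comb ⟨_, im_neg_one_div_pos τ⟩ ((τ : ℂ)⁻¹ • z) r
  change ∑' k, L.thetaTerm (-1 / τ) _ _ = ∏ i, ∑' k, gaussTerm _ (-1 / τ) _ _ at product_formula
  rw [product_formula, tsum_thetaTerm_dualPt, gaussian_factor, constant_factor,
    ← Finset.prod_mul_distrib, ← Finset.prod_mul_distrib]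
  refine Finset.prod_congr rfl fun i _ ↦ ?_
  rw [zeta_smul, inv_mul_eq_div,
    tsum_gaussTerm_inversion (Int.cast_pos.2 (F.len_pos i)) τ (F.zeta z i) (F.coord r i)]

/-- The constant of the inversion formula, which equals `1 / √(det L)`. -/
def fourierConst : ℝ := (∏ i, √(F.len i : ℝ)⁻¹) * Nat.card (L ⧸ F.sublattice)

theorem fourierConst_pos : 0 < F.fourierConst :=
  mul_pos (Finset.prod_pos fun i _ ↦ Real.sqrt_pos.2 (inv_pos.2 (Int.cast_pos.2 (F.len_pos i))))
    (Nat.cast_pos.2 Nat.card_pos)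

theorem tsum_cosetEquiv_inversion (τ : ℍ) (z : L.CplxSpace) (r : L.shadow)
    (q : L ⧸ F.sublattice) :
    (∑' k, L.signChar (F.cosetEquiv (q, k)) *
        L.thetaTerm (-1 / τ) ((τ : ℂ)⁻¹ • z) (F.cosetEquiv (q, k) +ᵥ r : L.shadow)) *
        e (-(L.formC z z / 2) / τ) =
      (∏ i, √(F.len i : ℝ)⁻¹ : ℝ) * sqrtNegI τ ^ L.rank *
        ∑' k, L.shadowChar (F.dualPt k) q.out *
          (e (-L.formQ r (F.dualPt k)) * L.thetaTerm τ z (F.dualPt k)) := by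
  have term_eq (k : Fin L.rank → ℤ) : L.signChar (F.cosetEquiv (q, k)) *
      L.thetaTerm (-1 / τ) ((τ : ℂ)⁻¹ • z) (F.cosetEquiv (q, k) +ᵥ r : L.shadow) =
        L.signChar q.out *
          L.thetaTerm (-1 / τ) ((τ : ℂ)⁻¹ • z) (r + L.toRat q.out + L.toRat (F.comb k)) := by
    rw [cosetEquiv_apply, AddChar.map_add_eq_mul, signChar_comb, mul_one, coe_vadd_shadow,
      toRat_add, add_assoc]
  rw [tsum_congr term_eq, tsum_mul_left, mul_assoc, tsum_thetaTerm_inversion, mul_left_comm,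
    ← tsum_mul_left]
  refine congrArg _ (tsum_congr fun k ↦ ?_)
  rw [shadowChar_apply, map_add, LinearMap.add_apply, Rat.cast_add, neg_add, e_add,
    L.formQ_symm (L.toRat q.out)]
  ring

theorem tsum_coset_inversion (τ : ℍ) (z : L.CplxSpace) (r : L.shadow) :
    (∑' x : L, L.signChar x * L.thetaTerm (-1 / τ) ((τ : ℂ)⁻¹ • z) (x +ᵥ r : L.shadow)) *
        e (-(L.formC z z / 2) / τ) =
      F.fourierConst * sqrtNegI τ ^ L.rank *
        ∑' s : L.shadow, e (-L.formQ r s) * L.thetaTerm τ z s := by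
  classical
  let := Fintype.ofFinite (L ⧸ F.sublattice)
  have coset_summable : Summable fun x : L ↦
      L.signChar x * L.thetaTerm (-1 / τ) ((τ : ℂ)⁻¹ • z) (x +ᵥ r : L.shadow) := by
    refine Summable.of_norm ?_
    simp only [norm_mul, norm_signChar, one_mul]
    exact (F.summable_thetaTerm ⟨_, im_neg_one_div_pos τ⟩ _).comp_injective
      fun x y ↦ vadd_shadow_right_cancel
  have dual_summable (q : L ⧸ F.sublattice) : Summable fun k ↦ L.shadowChar (F.dualPt k) q.out *
      (e (-L.formQ r (F.dualPt k)) * L.thetaTerm τ z (F.dualPt k)) := by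
    refine Summable.of_norm ((F.summable_thetaTerm_dualPt τ z).congr fun k ↦ ?_)
    rw [norm_mul, norm_mul, shadowChar_apply, norm_mul, norm_signChar, norm_e_neg_formQ,
      norm_e_neg_formQ, one_mul, one_mul, one_mul]
  have character_sum (k : Fin L.rank → ℤ) : ∑ q : L ⧸ F.sublattice,
      L.shadowChar (F.dualPt k) q.out *
        (e (-L.formQ r (F.dualPt k)) * L.thetaTerm τ z (F.dualPt k)) =
      Nat.card (L ⧸ F.sublattice) * if F.dualPt k ∈ L.shadow then
        e (-L.formQ r (F.dualPt k)) * L.thetaTerm τ z (F.dualPt k) else 0 := by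
    rw [← Finset.sum_mul, sum_shadowChar_dualPt, ite_mul, zero_mul, mul_ite, mul_zero]
  have coset_decomposition := (F.cosetEquiv.summable_iff.2 coset_summable).tsum_prod
  simp only [Function.comp_apply] at coset_decomposition
  rw [← F.cosetEquiv.tsum_eq, coset_decomposition, tsum_fintype, Finset.sum_mul,
    Finset.sum_congr rfl fun q _ ↦ F.tsum_cosetEquiv_inversion τ z r q,
    ← Finset.mul_sum, ← Summable.tsum_finsetSum fun q _ ↦ dual_summable q, tsum_congr character_sum,
    tsum_mul_left,
    F.tsum_ite_dualPt_mem_shadow fun s ↦ e (-L.formQ r s) * L.thetaTerm τ z s, fourierConst]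
  push_cast
  ring

end OrthFrame

end IntegralLattice

/-! ### Generators of the metaplectic group -/

theorem sqrtNegI_sq (τ : ℍ) : sqrtNegI τ ^ 2 = -Complex.I * τ := by
  rw [sqrtNegI, ← Complex.cpow_nat_mul]
  simp

theorem sqrtNegI_ne_zero (τ : ℍ) : sqrtNegI τ ≠ 0 := fun h ↦ by
  simpa [h, τ.ne_zero] using sqrtNegI_sq τ

theorem sqrtNegI_I : sqrtNegI UpperHalfPlane.I = 1 := by
  simp [sqrtNegI]

theorem mdiff_sqrtNegI : MDiff sqrtNegI := by
  have : DifferentiableOn ℂ (fun z : ℂ ↦ (-Complex.I * z) ^ (1 / 2 : ℂ)) {z | 0 < z.im} :=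
    fun z hz ↦ (DifferentiableAt.cpow_const (by fun_prop)
      (Or.inl (by simpa using hz))).differentiableWithinAt
  rw [mdifferentiable_iff]
  exact this.congr fun z hz ↦ by simp [sqrtNegI, ofComplex_apply_of_im_pos hz]

theorem e_one_fourth : e (1 / 4) = Complex.I := by
  rw [e, show (2 * Real.pi * Complex.I * (1 / 4) : ℂ) = Real.pi / 2 * Complex.I by ring]
  exact Complex.exp_pi_div_two_mul_I

theorem e_one_eighth_sq : e (1 / 8) ^ 2 = Complex.I := by
  rw [sq, ← e_add, ← e_one_fourth]
  norm_num

namespace Mp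

/-- The lift `(T, 1)` of the translation `T`. -/
def T : Mp where
  mat := ModularGroup.T
  root _ := 1
  holo := mdifferentiable_const
  root_sq τ := by simp [autFactor, ModularGroup.T]

/-- The lift `(S, √τ)` of the inversion `S`. -/
def S : Mp where
  mat := ModularGroup.S
  root τ := e (1 / 8) * sqrtNegI τ
  holo := mdifferentiable_const.mul mdiff_sqrtNegI
  root_sq τ := by
    rw [mul_pow, sqrtNegI_sq, e_one_eighth_sq]
    simp [autFactor, ModularGroup.S, ← mul_assoc]

@[simp] theorem mat_T : T.mat = ModularGroup.T := rfl
@[simp] theorem mat_S : S.mat = ModularGroup.S := rfl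
@[simp] theorem root_T (τ : ℍ) : T.root τ = 1 := rfl
@[simp] theorem root_S (τ : ℍ) : S.root τ = e (1 / 8) * sqrtNegI τ := rfl

theorem coe_T_smul (τ : ℍ) : ((ModularGroup.T • τ : ℍ) : ℂ) = τ + 1 := by
  rw [coe_smul_eq]
  simp [autFactor, ModularGroup.T]

theorem coe_S_smul (τ : ℍ) : ((ModularGroup.S • τ : ℍ) : ℂ) = -1 / τ := by
  rw [coe_smul_eq]
  simp [autFactor, ModularGroup.S]

/-- The projection from the metaplectic group to `SL(2, ℤ)`. -/
def toSL : Mp →* SL(2, ℤ) where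
  toFun := mat
  map_one' := rfl
  map_mul' _ _ := rfl

theorem toSL_apply (α : Mp) : toSL α = α.mat := rfl

theorem epsilon_T : (epsilon T : ℂ) = e (1 / 24) := by
  rw [epsilon_apply _ UpperHalfPlane.I, etaQuotient, mat_T, root_T, mul_one,
    div_eq_iff (eta_coe_ne_zero _), coe_T_smul, ModularForm.eta, ModularForm.eta, ← mul_assoc]
  congr 1
  · rw [Function.Periodic.qParam, Function.Periodic.qParam, e, ← Complex.exp_add]
    push_cast
    congr 1
    ring
  · refine tprod_congr fun n ↦ ?_
    rw [ModularForm.eta_q_eq_pow, ModularForm.eta_q_eq_pow, mul_add, mul_one, Complex.exp_add,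
      Complex.exp_two_pi_mul_I, mul_one]

theorem epsilon_S : (epsilon S : ℂ) = e (-(1 / 8)) := by
  have S_smul_I : ModularGroup.S • UpperHalfPlane.I = UpperHalfPlane.I := by
    ext
    rw [coe_S_smul]
    simp [neg_div]
  rw [epsilon_apply _ UpperHalfPlane.I, etaQuotient, mat_S, root_S, S_smul_I, sqrtNegI_I, mul_one,
    div_mul_cancel_left₀ (eta_coe_ne_zero _), e_neg]

theorem eq_of_epsilon_eq {α β : Mp} (mat_eq : α.mat = β.mat)
    (epsilon_eq : (epsilon α : ℂ) = epsilon β) : α = β := by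
  ext τ
  · rw [mat_eq]
  · rw [epsilon_apply α τ, epsilon_apply β τ, etaQuotient, etaQuotient, mat_eq, div_eq_mul_inv,
      div_eq_mul_inv, mul_right_inj' (eta_coe_ne_zero _), inv_inj,
      mul_right_inj' (eta_coe_ne_zero τ)] at epsilon_eq
    exact epsilon_eq

theorem ST_cubed : (S * T) ^ 3 = S ^ 2 := by
  refine eq_of_epsilon_eq ?_ ?_
  · simp only [← toSL_apply, map_pow, map_mul]
    decide
  · simp only [map_pow, map_mul, Units.val_pow_eq_pow_val, Units.val_mul, epsilon_S, epsilon_T,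
      ← e_add, ← e_natCast_mul]
    norm_num

theorem S_pow_eight : S ^ 8 = 1 := by
  refine eq_of_epsilon_eq ?_ ?_
  · simp only [← toSL_apply, map_pow, map_one]
    decide
  · rw [map_pow, map_one, Units.val_pow_eq_pow_val, epsilon_S, ← e_natCast_mul, Units.val_one]
    exact (e_eq_one_iff _).2 ⟨-1, by norm_num⟩

theorem eq_or_eq_mul_S_pow_four {α β : Mp} (mat_eq : α.mat = β.mat) :
    α = β ∨ α = β * S ^ 4 := by
  have mat_S_pow_four : toSL (S ^ 4) = 1 := by
    simp only [map_pow, toSL_apply, mat_S]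
    decide
  have epsilon_S_pow_four : (epsilon (S ^ 4) : ℂ) = -1 := by
    rw [map_pow, Units.val_pow_eq_pow_val, epsilon_S, ← e_natCast_mul, e]
    convert Complex.exp_neg_pi_mul_I
    push_cast
    ring
  have epsilon_sq : (epsilon α : ℂ) ^ 2 = epsilon β ^ 2 := by
    rw [epsilon_apply α I, epsilon_apply β I, etaQuotient, etaQuotient, div_pow, div_pow, mul_pow,
      mul_pow, α.root_sq, β.root_sq, mat_eq]
  rcases sq_eq_sq_iff_eq_or_eq_neg.1 epsilon_sq with h | h
  · exact .inl (eq_of_epsilon_eq mat_eq h)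
  · refine .inr (eq_of_epsilon_eq ?_ ?_)
    · rw [← toSL_apply (β * S ^ 4), map_mul, mat_S_pow_four, mul_one, toSL_apply, mat_eq]
    · rw [map_mul, Units.val_mul, epsilon_S_pow_four, h, mul_neg_one]

theorem closure_S_T : Subgroup.closure {S, T} = ⊤ := by
  have map_closure : (Subgroup.closure {S, T}).map toSL = ⊤ := by
    rw [MonoidHom.map_closure, Set.image_pair]
    exact SpecialLinearGroup.SL2Z_generators
  have S_mem : S ∈ Subgroup.closure {S, T} := Subgroup.subset_closure (.inl rfl)
  refine (Subgroup.eq_top_iff' _).2 fun α ↦ ?_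
  obtain ⟨β, β_mem, β_eq⟩ : toSL α ∈ (Subgroup.closure {S, T}).map toSL := map_closure ▸ trivial
  rcases eq_or_eq_mul_S_pow_four (α := α) (β := β) β_eq.symm with rfl | rfl
  · exact β_mem
  · exact mul_mem β_mem (pow_mem S_mem 4)

/-- A submonoid is closed under inverses here because `S` and `S * T` have finite order. -/
theorem submonoid_eq_top {N : Submonoid Mp} (S_mem : S ∈ N) (T_mem : T ∈ N) : N = ⊤ := by
  have finite_order : ∀ α ∈ ({S, S * T} : Set Mp), IsOfFinOrder α := by
    have ST_pow : (S * T) ^ 12 = 1 := by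
      rw [show 12 = 3 * 4 from rfl, pow_mul, ST_cubed, ← pow_mul, S_pow_eight]
    rintro α (rfl | rfl)
    · exact isOfFinOrder_iff_pow_eq_one.2 ⟨8, by norm_num, S_pow_eight⟩
    · exact isOfFinOrder_iff_pow_eq_one.2 ⟨12, by norm_num, ST_pow⟩
  have closure_eq : Subgroup.closure {S, S * T} = ⊤ := by
    have S_mem : S ∈ Subgroup.closure {S, S * T} := Subgroup.subset_closure (.inl rfl)
    rw [eq_top_iff, ← closure_S_T, Subgroup.closure_le]
    rintro α (rfl | rfl)
    · exact S_mem
    · exact (Subgroup.mul_mem_cancel_left _ S_mem).1 (Subgroup.subset_closure (.inr rfl))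
  rw [eq_top_iff, ← Subgroup.top_toSubmonoid, ← closure_eq,
    Subgroup.closure_toSubmonoid_of_isOfFinOrder finite_order, Submonoid.closure_le]
  rintro α (rfl | rfl)
  · exact S_mem
  · exact mul_mem S_mem T_mem

end Mp

/-! ### The generators acting on theta functions -/

namespace IntegralLattice

variable {L : IntegralLattice.{u}}

/-- Multiplication by `e(β(r, r) / 2)`, the operator on `W(L)` through which `T` acts on theta
functions. -/
def mulPhase (l : L.W) : L.W where
  val r := e (L.formQ r r / 2 : ℚ) * l.1 r
  property := mem_W_iff.2 fun x r ↦ by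
    obtain ⟨m, hm⟩ := r.2 x
    have phase_invariant : e (L.formQ (x +ᵥ r : L.shadow) (x +ᵥ r : L.shadow) / 2 : ℚ) =
        e (L.formQ r r / 2 : ℚ) := by
      refine e_eq_of_sub_eq_intCast (m := m + L.form x x) ?_
      rw [← Rat.cast_sub, ← Rat.cast_intCast, Rat.cast_inj]
      simp only [coe_vadd_shadow, map_add, LinearMap.add_apply, formQ_toRat,
        L.formQ_symm (L.toRat x)]
      push_cast
      rw [← hm]
      ring
    rw [phase_invariant, W_apply_vadd l.2, mul_left_comm]

theorem mulPhase_apply (l : L.W) (r : L.shadow) :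
    (mulPhase l).1 r = e (L.formQ r r / 2 : ℚ) * l.1 r := rfl

/-- The unnormalized discrete Fourier transform on the cosets of the shadow, the operator on `W(L)`
through which `S` acts on theta functions. The sum does not depend on the representatives. -/
def fourierTransform (l : L.W) : L.W where
  val s := ∑' q : L.ShadowQuot, e (-L.formQ q.out s) * l.1 q.out
  property := mem_W_iff.2 fun x r ↦ by simp only [e_neg_formQ_vadd, mul_assoc, tsum_mul_left]

theorem fourierTransform_apply (l : L.W) (s : L.shadow) :
    (fourierTransform l).1 s = ∑' q : L.ShadowQuot, e (-L.formQ q.out s) * l.1 q.out := rfl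

theorem theta_apply (l : L.shadow → ℂ) (τ : ℍ) (z : L.CplxSpace) :
    L.theta l τ z = ∑' r : L.shadow, l r * L.thetaTerm τ z r := by
  simp only [theta, thetaTerm, mul_assoc]

theorem slash_T_apply (φ : ℍ → L.CplxSpace → ℂ) (τ : ℍ) (z : L.CplxSpace) :
    L.slash φ Mp.T τ z = φ (ModularGroup.T • τ) z := by
  simp [slash, autFactor, ModularGroup.T, e_zero]

theorem slash_S_apply (φ : ℍ → L.CplxSpace → ℂ) (τ : ℍ) (z : L.CplxSpace) :
    L.slash φ Mp.S τ z = φ (ModularGroup.S • τ) ((τ : ℂ)⁻¹ • z) * e (-(L.formC z z / 2) / τ) *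
      (e (-(L.rank / 8)) * (sqrtNegI τ)⁻¹ ^ L.rank) := by
  have eighth_root : e (-(L.rank / 8)) = (e (1 / 8))⁻¹ ^ L.rank := by
    rw [← e_neg, ← e_natCast_mul]
    congr 1
    ring
  rw [eighth_root, ← mul_pow, ← mul_inv]
  simp [slash, autFactor, ModularGroup.S]

theorem slash_T_theta (l : L.W) : L.slash (L.theta l.1) Mp.T = L.theta (mulPhase l).1 := by
  ext τ z
  rw [slash_T_apply, theta_apply, theta_apply]
  refine tsum_congr fun r ↦ ?_
  rw [thetaTerm, thetaTerm, Mp.coe_T_smul, mul_add, e_add, mul_one, mulPhase_apply]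
  ring

namespace OrthFrame

variable (F : L.OrthFrame)

include F

theorem exists_norm_W_le (l : L.W) : ∃ C, ∀ r, ‖l.1 r‖ ≤ C := by
  have := F.finite_shadowQuot
  obtain ⟨C, hC⟩ := Finite.bddAbove_range fun q : L.ShadowQuot ↦ ‖l.1 q.out‖
  refine ⟨C, fun r ↦ ?_⟩
  obtain ⟨p, rfl⟩ := L.shadowEquiv.surjective r
  rw [shadowEquiv_apply, W_apply_vadd l.2, norm_mul, norm_signChar, one_mul]
  exact hC ⟨p.1, rfl⟩

theorem summable_norm_mul_thetaTerm (l : L.W) (τ : ℍ) (z : L.CplxSpace) :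
    Summable fun r : L.shadow ↦ ‖l.1 r * L.thetaTerm τ z r‖ := by
  obtain ⟨C, hC⟩ := F.exists_norm_W_le l
  refine Summable.of_nonneg_of_le (fun r ↦ norm_nonneg _) (fun r ↦ ?_)
    ((F.summable_thetaTerm τ z).mul_left C)
  rw [norm_mul]
  exact mul_le_mul_of_nonneg_right (hC r) (norm_nonneg _)

theorem theta_eq_sum_cosets [Fintype L.ShadowQuot] (l : L.W) (τ : ℍ) (z : L.CplxSpace) :
    L.theta l.1 τ z = ∑ q : L.ShadowQuot,
      l.1 q.out * ∑' x : L, L.signChar x * L.thetaTerm τ z (x +ᵥ q.out : L.shadow) := by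
  have coset_decomposition :=
    (L.shadowEquiv.summable_iff.2 (F.summable_norm_mul_thetaTerm l τ z).of_norm).tsum_prod
  rw [theta_apply, ← L.shadowEquiv.tsum_eq]
  refine coset_decomposition.trans ?_
  rw [tsum_fintype]
  refine Finset.sum_congr rfl fun q _ ↦ ?_
  rw [← tsum_mul_left]
  refine tsum_congr fun x ↦ ?_
  rw [Function.comp_apply, shadowEquiv_apply, W_apply_vadd l.2, mul_left_comm, mul_assoc]

theorem theta_fourierTransform [Fintype L.ShadowQuot] (l : L.W) (τ : ℍ) (z : L.CplxSpace) :
    L.theta (fourierTransform l).1 τ z = ∑ q : L.ShadowQuot,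
      l.1 q.out * ∑' s : L.shadow, e (-L.formQ q.out s) * L.thetaTerm τ z s := by
  have term_summable (q : L.ShadowQuot) : Summable fun s : L.shadow ↦
      l.1 q.out * (e (-L.formQ q.out s) * L.thetaTerm τ z s) := by
    refine Summable.mul_left _ (Summable.of_norm ((F.summable_thetaTerm τ z).congr fun s ↦ ?_))
    rw [norm_mul, norm_e_neg_formQ, one_mul]
  simp only [← tsum_mul_left]
  rw [← Summable.tsum_finsetSum fun q _ ↦ term_summable q, theta_apply]
  refine tsum_congr fun s ↦ ?_
  rw [fourierTransform_apply, tsum_fintype, Finset.sum_mul]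
  exact Finset.sum_congr rfl fun q _ ↦ by ring

theorem slash_S_theta (l : L.W) : L.slash (L.theta l.1) Mp.S =
    (F.fourierConst * e (-(L.rank / 8))) • L.theta (fourierTransform l).1 := by
  have := F.finite_shadowQuot
  let := Fintype.ofFinite L.ShadowQuot
  ext τ z
  have inversion : L.theta l.1 (ModularGroup.S • τ) ((τ : ℂ)⁻¹ • z) *
      e (-(L.formC z z / 2) / τ) =
        F.fourierConst * sqrtNegI τ ^ L.rank * L.theta (fourierTransform l).1 τ z := by
    rw [F.theta_eq_sum_cosets, F.theta_fourierTransform, Finset.sum_mul, Finset.mul_sum]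
    refine Finset.sum_congr rfl fun q _ ↦ ?_
    rw [Mp.coe_S_smul, mul_assoc, F.tsum_coset_inversion, mul_left_comm]
  have root_cancel : sqrtNegI τ ^ L.rank * (sqrtNegI τ)⁻¹ ^ L.rank = 1 := by
    rw [← mul_pow, mul_inv_cancel₀ (sqrtNegI_ne_zero τ), one_pow]
  rw [slash_S_apply, inversion, Pi.smul_apply, Pi.smul_apply, smul_eq_mul]
  linear_combination
    F.fourierConst * e (-(L.rank / 8)) * L.theta (fourierTransform l).1 τ z * root_cancel

/-- In `z`, the theta function is a Fourier series on the lattice spanned by the dual frame. -/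
theorem theta_eq_tsum_intCoord (l : L.shadow → ℂ) (τ : ℍ) {z : L.CplxSpace} {x : Fin L.rank → ℝ}
    (hz : F.zeta z = fun i ↦ (x i : ℂ) * F.len i) :
    L.theta l τ z =
      ∑' r : L.shadow, l r * L.thetaTerm τ 0 r * e (∑ i, F.intCoord r i * x i) := by
  rw [theta_apply]
  refine tsum_congr fun r ↦ ?_
  have pairing : L.formC (L.toCplx r) z = ∑ i, (F.intCoord r i : ℂ) * x i := by
    conv_lhs => rw [← F.dualPt_intCoord r, dualPt, F.formC_toCplx_pt, hz]
    refine Finset.sum_congr rfl fun i _ ↦ ?_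
    have := F.len_ne_zero ℂ i
    push_cast
    field_simp
  rw [thetaTerm, thetaTerm, map_zero, e_zero, mul_one, pairing, mul_assoc]

theorem eq_zero_of_theta_eq_zero (l : L.W) (h : L.theta l.1 = 0) : l = 0 := by
  let a (r : L.shadow) : ℂ := l.1 r * L.thetaTerm UpperHalfPlane.I 0 r
  let c : (Fin L.rank → ℤ) → ℂ := Function.extend F.intCoord a 0
  have c_intCoord (r : L.shadow) : c (F.intCoord r) = a r :=
    F.intCoord_injective.extend_apply _ _ r
  have c_eq_zero {k : Fin L.rank → ℤ} (hk : k ∉ Set.range F.intCoord) : c k = 0 :=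
    Function.extend_apply' _ _ _ hk
  have c_summable : Summable fun k ↦ ‖c k‖ := by
    rw [← F.intCoord_injective.summable_iff fun k hk ↦ by rw [c_eq_zero hk, norm_zero]]
    refine (F.summable_norm_mul_thetaTerm l UpperHalfPlane.I 0).congr fun r ↦ ?_
    rw [Function.comp_apply, c_intCoord]
  have c_zero : c = 0 := by
    refine eq_zero_of_tsum_mul_e_eq_zero c_summable fun x ↦ ?_
    obtain ⟨z, hz⟩ := F.zeta_surjective fun i ↦ (x i : ℂ) * F.len i
    rw [← F.intCoord_injective.tsum_eq fun k hk ↦ by_contra fun hk' ↦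
      hk (by rw [c_eq_zero hk', zero_mul])]
    simp only [c_intCoord, a]
    rw [← F.theta_eq_tsum_intCoord _ _ hz, h, Pi.zero_apply, Pi.zero_apply]
  ext r
  have a_zero : l.1 r * L.thetaTerm UpperHalfPlane.I 0 r = 0 := by
    simpa only [c_zero, Pi.zero_apply, eq_comm] using c_intCoord r
  exact (mul_eq_zero.1 a_zero).resolve_right (mul_ne_zero (e_ne_zero _) (e_ne_zero _))

/-- The linear map `l ↦ θ_l` from `W(L)` to functions on `ℍ × (ℂ ⊗ L)`. -/
def thetaMap : L.W →ₗ[ℂ] ℍ → L.CplxSpace → ℂ where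
  toFun l := L.theta l.1
  map_add' l m := by
    ext τ z
    simp only [Pi.add_apply, theta_apply, Submodule.coe_add, add_mul]
    exact (F.summable_norm_mul_thetaTerm l τ z).of_norm.tsum_add
      (F.summable_norm_mul_thetaTerm m τ z).of_norm
  map_smul' a l := by
    ext τ z
    simp only [Pi.smul_apply, theta_apply, Submodule.coe_smul, smul_eq_mul, mul_assoc,
      tsum_mul_left, RingHom.id_apply]

theorem thetaMap_injective : Function.Injective F.thetaMap :=
  (injective_iff_map_eq_zero F.thetaMap).2 F.eq_zero_of_theta_eq_zero

theorem range_thetaMap : LinearMap.range F.thetaMap = L.Theta := by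
  have image_eq : L.theta '' (L.W : Set (L.shadow → ℂ)) = LinearMap.range F.thetaMap := by
    rw [LinearMap.coe_range, Set.image_eq_range]
    rfl
  rw [Theta, image_eq, Submodule.span_eq]

/-- The linear isomorphism `l ↦ θ_l` between `W(L)` and `Θ(L)`. -/
def thetaEquiv : L.W ≃ₗ[ℂ] L.Theta :=
  (LinearEquiv.ofInjective F.thetaMap F.thetaMap_injective).trans
    (LinearEquiv.ofEq _ _ F.range_thetaMap)

end OrthFrame

end IntegralLattice

/-! ### Maps between shadows -/

universe w

namespace IntegralLattice

variable {L : IntegralLattice.{u}} {M : IntegralLattice.{v}}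

/-- A linear isomorphism between the spaces `W` that commutes with the phase operators and with the
Fourier transforms up to the constants that arise when the shadow is translated by a vector `u`
orthogonal to it with `β(u, u) = k`. -/
structure Intertwines (Ψ : L.W ≃ₗ[ℂ] M.W) (k : ℚ) : Prop where
  map_mulPhase (l : L.W) : Ψ (mulPhase l) = e (k / 2 : ℚ) • mulPhase (Ψ l)
  map_fourierTransform (l : L.W) : Ψ (fourierTransform l) = e (-k) • fourierTransform (Ψ l)

theorem Intertwines.symm {Ψ : L.W ≃ₗ[ℂ] M.W} {k : ℚ} (h : Intertwines Ψ k) :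
    Intertwines Ψ.symm (-k) where
  map_mulPhase l := by
    have := h.map_mulPhase (Ψ.symm l)
    rw [LinearEquiv.apply_symm_apply] at this
    rw [LinearEquiv.symm_apply_eq, map_smul, this, smul_smul, ← e_add, ← Rat.cast_add, neg_div,
      neg_add_cancel, Rat.cast_zero, e_zero, one_smul]
  map_fourierTransform l := by
    have := h.map_fourierTransform (Ψ.symm l)
    rw [LinearEquiv.apply_symm_apply] at this
    rw [LinearEquiv.symm_apply_eq, map_smul, this, smul_smul, ← e_add, Rat.cast_neg, neg_neg,
      add_neg_cancel, e_zero, one_smul]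

theorem Intertwines.trans {N : IntegralLattice.{w}} {Ψ : L.W ≃ₗ[ℂ] M.W} {Φ : M.W ≃ₗ[ℂ] N.W}
    {k m : ℚ} (h : Intertwines Ψ k) (h' : Intertwines Φ m) :
    Intertwines (Ψ.trans Φ) (k + m) where
  map_mulPhase l := by
    rw [LinearEquiv.trans_apply, h.map_mulPhase, map_smul, h'.map_mulPhase, smul_smul, ← e_add,
      ← Rat.cast_add, ← add_div]
    rfl
  map_fourierTransform l := by
    rw [LinearEquiv.trans_apply, h.map_fourierTransform, map_smul, h'.map_fourierTransform,
      smul_smul, ← e_add, ← neg_add, ← Rat.cast_add]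
    rfl

variable (L M) in
/-- A map between the shadows of two lattices that is compatible with translations, induces a
bijection of the cosets, and changes the values of the form by a constant. -/
structure ShadowMap where
  map : L.shadow → M.shadow
  base : L → M
  const : ℚ
  signChar_base (x : L) : M.signChar (base x) = L.signChar x
  map_vadd (x : L) (r : L.shadow) : map (x +ᵥ r) = base x +ᵥ map r
  formQ_map (r s : L.shadow) : M.formQ (map r) (map s) = L.formQ r s + const
  exists_vadd_map_eq (s : M.shadow) : ∃ (r : L.shadow) (y : M), y +ᵥ map r = s
  exists_vadd_eq_of_vadd_map_eq {r s : L.shadow} {y : M} (h : y +ᵥ map r = map s) :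
    ∃ x : L, x +ᵥ r = s

namespace ShadowMap

variable (j : ShadowMap L M)

/-- Restriction of functions along a map between shadows. -/
def restrict : M.W →ₗ[ℂ] L.W where
  toFun l := ⟨fun r ↦ l.1 (j.map r), mem_W_iff.2 fun x r ↦ by
    rw [j.map_vadd, W_apply_vadd l.2, j.signChar_base]⟩
  map_add' _ _ := rfl
  map_smul' _ _ := rfl

theorem restrict_apply (l : M.W) (r : L.shadow) : (j.restrict l).1 r = l.1 (j.map r) := rfl

theorem restrict_injective : Function.Injective j.restrict := by
  rw [injective_iff_map_eq_zero]
  intro l h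
  ext s
  obtain ⟨r, y, rfl⟩ := j.exists_vadd_map_eq s
  rw [W_apply_vadd l.2, ← j.restrict_apply, h]
  exact mul_zero _

theorem signChar_mul_apply_eq (l : L.W) {r r' : L.shadow} {y y' : M}
    (h : y +ᵥ j.map r = y' +ᵥ j.map r') :
    M.signChar y * l.1 r = M.signChar y' * l.1 r' := by
  have map_r' : (-y' + y) +ᵥ j.map r = j.map r' := by rw [add_vadd, h, neg_vadd_vadd]
  obtain ⟨x, rfl⟩ := j.exists_vadd_eq_of_vadd_map_eq map_r'
  have y_eq : y = y' + j.base x := by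
    rw [j.map_vadd, vadd_vadd] at h
    exact vadd_shadow_right_cancel h
  rw [W_apply_vadd l.2, y_eq, AddChar.map_add_eq_mul, j.signChar_base, mul_assoc]

theorem restrict_surjective : Function.Surjective j.restrict := fun l ↦ by
  choose r y hry using j.exists_vadd_map_eq
  refine ⟨⟨fun s ↦ M.signChar (y s) * l.1 (r s), mem_W_iff.2 fun x s ↦ ?_⟩, ?_⟩
  · rw [← mul_assoc, ← AddChar.map_add_eq_mul]
    exact j.signChar_mul_apply_eq l (by rw [hry, add_vadd, hry])
  · ext s
    rw [restrict_apply, ← one_mul (l.1 s), ← AddChar.map_zero_eq_one M.signChar]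
    exact j.signChar_mul_apply_eq l (by rw [hry, zero_vadd])

/-- Restriction along a map between shadows as a linear isomorphism. -/
def equiv : M.W ≃ₗ[ℂ] L.W :=
  LinearEquiv.ofBijective j.restrict ⟨j.restrict_injective, j.restrict_surjective⟩

theorem equiv_apply (l : M.W) (r : L.shadow) : (j.equiv l).1 r = l.1 (j.map r) := rfl

/-- The bijection between the cosets. -/
def quotEquiv : L.ShadowQuot ≃ M.ShadowQuot :=
  Equiv.ofBijective (fun q ↦ ⟦j.map q.out⟧) <| by
    constructor
    · intro p q h
      obtain ⟨y, hy⟩ := Quotient.exact h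
      rw [← Quotient.out_eq p, ← Quotient.out_eq q]
      exact Quotient.sound (j.exists_vadd_eq_of_vadd_map_eq hy)
    · intro q
      obtain ⟨r, y, hr⟩ := j.exists_vadd_map_eq q.out
      refine ⟨⟦r⟧, ?_⟩
      obtain ⟨x, hx⟩ := Quotient.mk_out (s := AddAction.orbitRel L L.shadow) r
      exact calc
        (⟦j.map (⟦r⟧ : L.ShadowQuot).out⟧ : M.ShadowQuot) = ⟦j.map r⟧ :=
          Quotient.sound (s := AddAction.orbitRel M M.shadow)
            ⟨j.base x, by rw [← hx]; exact (j.map_vadd x r).symm⟩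
        _ = ⟦q.out⟧ := (Quotient.sound (s := AddAction.orbitRel M M.shadow) ⟨y, hr⟩).symm
        _ = q := Quotient.out_eq q

theorem tsum_shadowQuot {f : M.shadow → ℂ} (hf : ∀ (y : M) s, f (y +ᵥ s) = f s) :
    ∑' q : M.ShadowQuot, f q.out = ∑' q : L.ShadowQuot, f (j.map q.out) := by
  rw [← j.quotEquiv.tsum_eq]
  refine tsum_congr fun q ↦ ?_
  obtain ⟨y, hy⟩ := Quotient.mk_out (s := AddAction.orbitRel M M.shadow) (j.map q.out)
  exact (congrArg f hy).symm.trans (hf y _)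

theorem intertwines_equiv : Intertwines j.equiv j.const where
  map_mulPhase l := by
    ext r
    change (mulPhase l).1 (j.map r) = e _ * (mulPhase (j.equiv l)).1 r
    rw [mulPhase_apply, mulPhase_apply, equiv_apply, ← mul_assoc, ← e_add, ← Rat.cast_add,
      j.formQ_map, ← add_div, add_comm]
  map_fourierTransform l := by
    have summand_invariant (s : L.shadow) (y : M) (r : M.shadow) :
        e (-M.formQ (y +ᵥ r : M.shadow) (j.map s)) * l.1 (y +ᵥ r) =
          e (-M.formQ r (j.map s)) * l.1 r := by
      rw [formQ_symm, e_neg_formQ_vadd, W_apply_vadd l.2, formQ_symm, mul_mul_mul_comm,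
        signChar_mul_self, one_mul]
    ext s
    change (fourierTransform l).1 (j.map s) = e _ * (fourierTransform (j.equiv l)).1 s
    rw [fourierTransform_apply, fourierTransform_apply, ← tsum_mul_left,
      j.tsum_shadowQuot (f := fun r ↦ e (-M.formQ r (j.map s)) * l.1 r) (summand_invariant s)]
    refine tsum_congr fun q ↦ ?_
    rw [j.formQ_map, equiv_apply, Rat.cast_add, neg_add, e_add]
    ring

end ShadowMap

/-! ### Isometries and orthogonal sums -/

theorem toRat_map (f : L →ₗ[ℤ] M) (x : L) : M.toRat (f x) = f.baseChange ℚ (L.toRat x) := rfl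

theorem baseChange_comp_apply {N : IntegralLattice.{w}} (f : L →ₗ[ℤ] M) (g : M →ₗ[ℤ] N)
    (r : L.RatSpace) : g.baseChange ℚ (f.baseChange ℚ r) = (g ∘ₗ f).baseChange ℚ r := by
  rw [LinearMap.baseChange_comp]
  rfl

theorem bilinQ_ext {B C : L.RatSpace →ₗ[ℚ] M.RatSpace →ₗ[ℚ] ℚ}
    (h : ∀ x y, B (L.toRat x) (M.toRat y) = C (L.toRat x) (M.toRat y)) : B = C := by
  ext x y
  exact h x y

theorem formQ_baseChange {f : L →ₗ[ℤ] M} (hf : ∀ x y, M.form (f x) (f y) = L.form x y)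
    (r s : L.RatSpace) : M.formQ (f.baseChange ℚ r) (f.baseChange ℚ s) = L.formQ r s := by
  have pullback_eq : M.formQ.compl₁₂ (f.baseChange ℚ) (f.baseChange ℚ) = L.formQ :=
    bilinQ_ext fun x y ↦ by
      rw [LinearMap.compl₁₂_apply, ← toRat_map, ← toRat_map, formQ_toRat, hf, formQ_toRat]
  exact LinearMap.congr_fun₂ pullback_eq r s

theorem baseChange_mem_shadow {f : L ≃ₗ[ℤ] M} (hf : ∀ x y, M.form (f x) (f y) = L.form x y)
    {r : L.RatSpace} (hr : r ∈ L.shadow) : f.toLinearMap.baseChange ℚ r ∈ M.shadow := fun y ↦ by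
  obtain ⟨x, rfl⟩ := f.surjective y
  obtain ⟨m, hm⟩ := hr x
  refine ⟨m, ?_⟩
  rw [hf, ← hm, ← formQ_baseChange hf]
  rfl

/-- The map between shadows induced by an isometry. -/
def ShadowMap.ofIsometry (f : L ≃ₗ[ℤ] M) (hf : ∀ x y, M.form (f x) (f y) = L.form x y) :
    ShadowMap L M where
  map r := ⟨f.toLinearMap.baseChange ℚ r, baseChange_mem_shadow hf r.2⟩
  base := f
  const := 0
  signChar_base x := by rw [signChar_apply, hf, signChar_apply]
  map_vadd x r := by
    ext
    simp only [coe_vadd_shadow, map_add]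
    rfl
  formQ_map r s := by rw [add_zero, formQ_baseChange hf]
  exists_vadd_map_eq s := by
    have hf_symm (x y : M) : L.form (f.symm x) (f.symm y) = M.form x y := by
      rw [← hf, f.apply_symm_apply, f.apply_symm_apply]
    refine ⟨⟨f.symm.toLinearMap.baseChange ℚ s, baseChange_mem_shadow hf_symm s.2⟩, 0, ?_⟩
    ext
    simp [baseChange_comp_apply]
  exists_vadd_eq_of_vadd_map_eq {r s y} h := by
    refine ⟨f.symm y, Subtype.ext ?_⟩
    have := congrArg (fun t : M.shadow ↦ f.symm.toLinearMap.baseChange ℚ (t : M.RatSpace)) h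
    simpa [baseChange_comp_apply, ← toRat_map] using this

section OrthSum

variable (L : IntegralLattice.{u}) (U : IntegralLattice.{v})

/-- The inclusion of the first summand. -/
def inl : L →ₗ[ℤ] L.orthSum U := LinearMap.inl ℤ L U

/-- The inclusion of the second summand. -/
def inr : U →ₗ[ℤ] L.orthSum U := LinearMap.inr ℤ L U

/-- The projection onto the first summand. -/
def fst : L.orthSum U →ₗ[ℤ] L := LinearMap.fst ℤ L U

/-- The projection onto the second summand. -/
def snd : L.orthSum U →ₗ[ℤ] U := LinearMap.snd ℤ L U

variable {L U}

@[simp] theorem fst_inl (r : L.RatSpace) :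
    (L.fst U).baseChange ℚ ((L.inl U).baseChange ℚ r) = r := by
  rw [baseChange_comp_apply, show L.fst U ∘ₗ L.inl U = .id from rfl]
  simp

@[simp] theorem fst_inr (r : U.RatSpace) :
    (L.fst U).baseChange ℚ ((L.inr U).baseChange ℚ r) = 0 := by
  rw [baseChange_comp_apply, show L.fst U ∘ₗ L.inr U = 0 from rfl]
  simp

@[simp] theorem snd_inl (r : L.RatSpace) :
    (L.snd U).baseChange ℚ ((L.inl U).baseChange ℚ r) = 0 := by
  rw [baseChange_comp_apply, show L.snd U ∘ₗ L.inl U = 0 from rfl]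
  simp

@[simp] theorem snd_inr (r : U.RatSpace) :
    (L.snd U).baseChange ℚ ((L.inr U).baseChange ℚ r) = r := by
  rw [baseChange_comp_apply, show L.snd U ∘ₗ L.inr U = .id from rfl]
  simp

theorem orthSum_ratSpace_ext {s t : (L.orthSum U).RatSpace}
    (fst_eq : (L.fst U).baseChange ℚ s = (L.fst U).baseChange ℚ t)
    (snd_eq : (L.snd U).baseChange ℚ s = (L.snd U).baseChange ℚ t) : s = t := by
  have decomposition (t : (L.orthSum U).RatSpace) :
      (L.inl U).baseChange ℚ ((L.fst U).baseChange ℚ t) +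
        (L.inr U).baseChange ℚ ((L.snd U).baseChange ℚ t) = t := by
    have sum_eq_id : L.inl U ∘ₗ L.fst U + L.inr U ∘ₗ L.snd U = .id :=
      LinearMap.ext fun x ↦ Prod.ext (add_zero _) (zero_add _)
    rw [baseChange_comp_apply, baseChange_comp_apply, ← LinearMap.add_apply,
      ← LinearMap.baseChange_add, sum_eq_id]
    simp
  rw [← decomposition s, fst_eq, snd_eq, decomposition]

theorem form_orthSum (x y : L.orthSum U) : (L.orthSum U).form x y =
    L.form (L.fst U x) (L.fst U y) + U.form (L.snd U x) (L.snd U y) :=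
  orthSum_form L U x y

theorem formQ_orthSum (s t : (L.orthSum U).RatSpace) : (L.orthSum U).formQ s t =
    L.formQ ((L.fst U).baseChange ℚ s) ((L.fst U).baseChange ℚ t) +
      U.formQ ((L.snd U).baseChange ℚ s) ((L.snd U).baseChange ℚ t) := by
  have form_eq : (L.orthSum U).formQ =
      L.formQ.compl₁₂ ((L.fst U).baseChange ℚ) ((L.fst U).baseChange ℚ) +
        U.formQ.compl₁₂ ((L.snd U).baseChange ℚ) ((L.snd U).baseChange ℚ) :=
    bilinQ_ext fun x y ↦ by
      rw [LinearMap.add_apply, LinearMap.add_apply, LinearMap.compl₁₂_apply,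
        LinearMap.compl₁₂_apply, ← toRat_map, ← toRat_map, ← toRat_map, ← toRat_map, formQ_toRat,
        formQ_toRat, formQ_toRat, form_orthSum, Int.cast_add]
  exact LinearMap.congr_fun₂ form_eq s t

theorem shadowChar_orthSum (t : (L.orthSum U).RatSpace) (x : L.orthSum U) :
    (L.orthSum U).shadowChar t x =
      L.shadowChar ((L.fst U).baseChange ℚ t) (L.fst U x) *
        U.shadowChar ((L.snd U).baseChange ℚ t) (L.snd U x) := by
  simp only [shadowChar_apply, signChar_apply, ← e_add, formQ_orthSum, form_orthSum, toRat_map]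
  push_cast
  congr 1
  ring

theorem mem_shadow_orthSum_iff (t : (L.orthSum U).RatSpace) : t ∈ (L.orthSum U).shadow ↔
    (L.fst U).baseChange ℚ t ∈ L.shadow ∧ (L.snd U).baseChange ℚ t ∈ U.shadow := by
  simp only [mem_shadow_iff, AddChar.eq_one_iff, shadowChar_orthSum]
  refine ⟨fun h ↦ ⟨fun x ↦ ?_, fun x ↦ ?_⟩, fun h x ↦ by rw [h.1, h.2, mul_one]⟩
  · refine Eq.trans ?_ (h (L.inl U x))
    rw [show L.snd U (L.inl U x) = 0 from rfl, AddChar.map_zero_eq_one, mul_one]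
    rfl
  · refine Eq.trans ?_ (h (L.inr U x))
    rw [show L.fst U (L.inr U x) = 0 from rfl, AddChar.map_zero_eq_one, one_mul]
    rfl

end OrthSum

/-! ### Unimodular lattices -/

namespace IsUnimodular

variable {U : IntegralLattice.{w}} (hU : U.IsUnimodular)

include hU

theorem eq_zero_of_formQ_toRat_eq_zero {r : U.RatSpace} (h : ∀ x, U.formQ r (U.toRat x) = 0) :
    r = 0 := by
  obtain ⟨m, x, hm, hx⟩ := U.exists_smul_eq_toRat r
  have x_eq_zero : x = 0 := by
    refine hU.1 (LinearMap.ext fun y ↦ ?_)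
    rw [map_zero, LinearMap.zero_apply, ← @Int.cast_eq_zero ℚ, ← formQ_toRat, ← hx, map_smul,
      LinearMap.smul_apply, h, smul_zero]
  rw [x_eq_zero, toRat_zero] at hx
  exact (smul_eq_zero.1 hx).resolve_left (by exact_mod_cast hm)

theorem exists_toRat_eq {r : U.RatSpace} (h : ∀ x, ∃ d : ℤ, U.formQ r (U.toRat x) = d) :
    ∃ y, U.toRat y = r := by
  choose d hd using h
  let f : U →+ ℤ := AddMonoidHom.mk' d fun x y ↦ by
    rw [← @Int.cast_inj ℚ, Int.cast_add, ← hd, ← hd, ← hd, toRat_add, map_add]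
  obtain ⟨y, hy⟩ := hU.2 f.toIntLinearMap
  refine ⟨y, sub_eq_zero.1 (hU.eq_zero_of_formQ_toRat_eq_zero fun x ↦ ?_)⟩
  rw [map_sub, LinearMap.sub_apply, formQ_toRat, hy, hd]
  exact sub_self _

theorem exists_vadd_eq (s t : U.shadow) : ∃ y : U, y +ᵥ s = t := by
  have integral_pairing (x : U) : ∃ d : ℤ, U.formQ (t - s) (U.toRat x) = d := by
    obtain ⟨m, hm⟩ := s.2 x
    obtain ⟨m', hm'⟩ := t.2 x
    refine ⟨m' - m, ?_⟩
    rw [map_sub, LinearMap.sub_apply, Int.cast_sub, ← hm, ← hm']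
    ring
  obtain ⟨y, hy⟩ := hU.exists_toRat_eq integral_pairing
  exact ⟨y, Subtype.ext (by rw [coe_vadd_shadow, hy, add_sub_cancel])⟩

/-- A characteristic vector exists because `x ↦ β(x, x)` is linear modulo `2`. -/
theorem exists_form_emod_two_eq : ∃ w : U, ∀ x, (2 : ℤ) ∣ U.form x x - U.form w x := by
  let b := Module.Free.chooseBasis ℤ U
  let f : U →ₗ[ℤ] ℤ := b.constr ℤ fun i ↦ U.form (b i) (b i)
  let norm_mod_two : U →+ ZMod 2 :=
    AddMonoidHom.mk' (fun x ↦ ((U.form x x : ℤ) : ZMod 2)) fun x y ↦ by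
      simp only [map_add, LinearMap.add_apply, U.symm y x]
      push_cast
      linear_combination (U.form x y : ZMod 2) * CharTwo.two_eq_zero (R := ZMod 2)
  have f_mod_two :
      (Int.castAddHom (ZMod 2)).toIntLinearMap ∘ₗ f = norm_mod_two.toIntLinearMap := by
    refine b.ext fun i ↦ ?_
    simp [f, norm_mod_two]
  obtain ⟨w, hw⟩ := hU.2 f
  refine ⟨w, fun x ↦ ?_⟩
  rw [hw]
  exact (ZMod.intCast_eq_intCast_iff_dvd_sub _ _ 2).1 (LinearMap.congr_fun f_mod_two x)

theorem shadow_nonempty : Nonempty U.shadow := by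
  obtain ⟨w, hw⟩ := hU.exists_form_emod_two_eq
  refine ⟨⟨(1 / 2 : ℚ) • U.toRat w, fun x ↦ ?_⟩⟩
  obtain ⟨m, hm⟩ := hw x
  refine ⟨-m, ?_⟩
  have form_eq : (U.form x x : ℚ) - U.form w x = 2 * m := by exact_mod_cast hm
  rw [map_smul, LinearMap.smul_apply, formQ_toRat, smul_eq_mul]
  push_cast
  linear_combination -(1 / 2 : ℚ) * form_eq

end IsUnimodular

theorem IsEven.zero_mem_shadow (hL : L.IsEven) : (0 : L.RatSpace) ∈ L.shadow := fun x ↦ by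
  obtain ⟨m, hm⟩ := hL x
  refine ⟨-m, ?_⟩
  rw [hm]
  simp

/-- The map `r ↦ (r, u)` from the shadow of `L` to the shadow of `L ⊥ U`, for a unimodular
lattice `U`. -/
def ShadowMap.ofUnimodular (L : IntegralLattice.{u}) {U : IntegralLattice.{w}}
    (hU : U.IsUnimodular) (u : U.shadow) : ShadowMap L (L.orthSum U) where
  map r := ⟨(L.inl U).baseChange ℚ r + (L.inr U).baseChange ℚ u,
    (mem_shadow_orthSum_iff _).2 (by simp)⟩
  base := L.inl U
  const := U.formQ u u
  signChar_base x := by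
    rw [signChar_apply, form_orthSum, signChar_apply]
    simp [show L.fst U (L.inl U x) = x from rfl, show L.snd U (L.inl U x) = 0 from rfl]
  map_vadd x r := by
    ext
    simp only [coe_vadd_shadow, map_add, toRat_map]
    abel
  formQ_map r s := by rw [formQ_orthSum]; simp
  exists_vadd_map_eq s := by
    have s_mem := (mem_shadow_orthSum_iff _).1 s.2
    obtain ⟨y, hy⟩ := hU.exists_vadd_eq u ⟨_, s_mem.2⟩
    refine ⟨⟨_, s_mem.1⟩, L.inr U y, Subtype.ext (orthSum_ratSpace_ext ?_ ?_)⟩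
    · simp [toRat_map]
    · simpa [toRat_map] using congrArg Subtype.val hy
  exists_vadd_eq_of_vadd_map_eq {r s y} h := by
    refine ⟨L.fst U y, Subtype.ext ?_⟩
    simpa [toRat_map] using congrArg
      (fun t : (L.orthSum U).shadow ↦ (L.fst U).baseChange ℚ (t : (L.orthSum U).RatSpace)) h

theorem exists_intertwines {U V : IntegralLattice.{w}} (hU : U.IsUnimodular)
    (hV : V.IsUnimodular) (s : U.shadow) (t : V.shadow)
    (h : (L.orthSum U).Isomorphic (M.orthSum V)) :
    ∃ Ψ : L.W ≃ₗ[ℂ] M.W, Intertwines Ψ (V.formQ t t - U.formQ s s) := by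
  obtain ⟨f, hf⟩ := h
  have step_L := (ShadowMap.ofUnimodular L hU s).intertwines_equiv.symm
  have step_isometry := (ShadowMap.ofIsometry f hf).intertwines_equiv.symm
  have step_M := (ShadowMap.ofUnimodular M hV t).intertwines_equiv
  have const_eq : V.formQ t t - U.formQ s s = -U.formQ s s + -0 + V.formQ t t := by ring
  exact ⟨_, const_eq ▸ (step_L.trans step_isometry).trans step_M⟩

end IntegralLattice

/-! ### Intertwining up to a scalar -/

section IntertwinesAt

variable {k G V V' : Type*} [Field k] [Group G] [AddCommGroup V] [Module k V] [AddCommGroup V']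
  [Module k V'] {ρ : Representation k G V} {σ : Representation k G V'} {Φ : V ≃ₗ[k] V'}
  {g h : G} {c d : k}

variable (ρ σ Φ g c) in
/-- The linear isomorphism `Φ` intertwines the actions of `g` up to the scalar `c`. -/
def IntertwinesAt : Prop := ∀ v, Φ (ρ g v) = c • σ g (Φ v)

namespace IntertwinesAt

theorem of_subsingleton [Subsingleton V] : IntertwinesAt ρ σ Φ g c := fun v ↦ by
  have := Φ.symm.injective.subsingleton
  exact Subsingleton.elim _ _

theorem one : IntertwinesAt ρ σ Φ 1 1 := fun v ↦ by simp

theorem mul (hg : IntertwinesAt ρ σ Φ g c) (hh : IntertwinesAt ρ σ Φ h d) :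
    IntertwinesAt ρ σ Φ (g * h) (c * d) := fun v ↦ by
  rw [map_mul, map_mul, Module.End.mul_apply, Module.End.mul_apply, hg, hh, map_smul, smul_smul]

theorem pow (hg : IntertwinesAt ρ σ Φ g c) (n : ℕ) : IntertwinesAt ρ σ Φ (g ^ n) (c ^ n) := by
  induction n with
  | zero => simpa only [pow_zero] using one
  | succ n ih => simpa only [pow_succ] using ih.mul hg

theorem inv (hg : IntertwinesAt ρ σ Φ g c) (hc : c ≠ 0) : IntertwinesAt ρ σ Φ g⁻¹ c⁻¹ :=
  fun v ↦ by
  rw [eq_inv_smul_iff₀ hc, ← σ.inv_self_apply g (Φ (ρ g⁻¹ v)), ← map_smul, ← hg,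
    ρ.self_inv_apply]

theorem scalar_unique [Nontrivial V] (hc : IntertwinesAt ρ σ Φ g c)
    (hd : IntertwinesAt ρ σ Φ g d) : c = d := by
  obtain ⟨v, hv⟩ := exists_ne (0 : V)
  have image_ne_zero : σ g (Φ v) ≠ 0 := by
    rwa [(σ.apply_bijective g).injective.ne_iff' (map_zero _), Φ.map_ne_zero_iff]
  exact smul_left_injective k image_ne_zero ((hc v).symm.trans (hd v))

end IntertwinesAt

end IntertwinesAt

section Mp

variable {V V' : Type*} [AddCommGroup V] [Module ℂ V] [AddCommGroup V'] [Module ℂ V']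
  {ρ : Representation ℂ Mp V} {σ : Representation ℂ Mp V'} {Φ : V ≃ₗ[ℂ] V'}

theorem IntertwinesAt.scalar_S_mul_scalar_T_pow [Nontrivial V] {s t : ℂ}
    (hS : IntertwinesAt ρ σ Φ Mp.S s) (hT : IntertwinesAt ρ σ Φ Mp.T t) (hs : s ≠ 0) :
    s * t ^ 3 = 1 := by
  have braid : (s * t) ^ 3 = s ^ 2 :=
    ((hS.mul hT).pow 3).scalar_unique (Mp.ST_cubed ▸ hS.pow 2)
  refine mul_left_cancel₀ (pow_ne_zero 2 hs) ?_
  linear_combination braid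

theorem Mp.map_S_mul_map_T_pow (χ : Mp →* ℂˣ) : (χ S : ℂ) * (χ T : ℂ) ^ 3 = 1 := by
  have braid := congrArg Units.val (congrArg χ ST_cubed)
  simp only [map_pow, map_mul, Units.val_pow_eq_pow_val, Units.val_mul] at braid
  refine mul_left_cancel₀ (pow_ne_zero 2 (χ S).ne_zero) ?_
  linear_combination braid

/-- The relation `(S * T) ^ 3 = S ^ 2` determines the scalar at `S` from the scalar at `T`. -/
theorem IntertwinesAt.of_character {χ : Mp →* ℂˣ} {s : ℂ}
    (hS : IntertwinesAt ρ σ Φ Mp.S s) (hT : IntertwinesAt ρ σ Φ Mp.T (χ Mp.T)) (hs : s ≠ 0)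
    (α : Mp) : IntertwinesAt ρ σ Φ α (χ α) := by
  rcases subsingleton_or_nontrivial V
  · exact .of_subsingleton
  have s_eq : s = χ Mp.S := mul_right_cancel₀ (pow_ne_zero 3 (χ Mp.T).ne_zero) <|
    (hS.scalar_S_mul_scalar_T_pow hT hs).trans (Mp.map_S_mul_map_T_pow χ).symm
  let N : Submonoid Mp :=
    { carrier := {α | IntertwinesAt ρ σ Φ α (χ α)}
      one_mem' := by simpa only [Set.mem_ofPred_eq, map_one] using .one
      mul_mem' hα hβ := by
        simpa only [Set.mem_ofPred_eq, map_mul, Units.val_mul] using hα.mul hβ }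
  have N_eq_top : N = ⊤ := Mp.submonoid_eq_top (s_eq ▸ hS :) hT
  exact (N_eq_top ▸ Submonoid.mem_top α : α ∈ N)

theorem nonempty_equiv_tprod_charRep {ψ χ : Mp →* ℂˣ}
    (h : ∀ α, IntertwinesAt ρ σ Φ α ((χ / ψ) α : ℂˣ)) :
    Nonempty ((ρ.tprod (charRep ψ)).Equiv (σ.tprod (charRep χ))) := by
  refine ⟨.mk (TensorProduct.congr Φ (.refl ℂ ℂ)) fun α ↦ TensorProduct.ext' fun v x ↦ ?_⟩
  have charRep_apply (χ : Mp →* ℂˣ) : charRep χ α x = (χ α : ℂ) • x := rfl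
  have scalar_eq : (ψ α : ℂ) * ((χ / ψ) α : ℂˣ) = χ α := by
    rw [← Units.val_mul, MonoidHom.div_apply, mul_div_cancel]
  change Φ (ρ α v) ⊗ₜ[ℂ] charRep ψ α x = σ α (Φ v) ⊗ₜ[ℂ] charRep χ α x
  rw [h α v, charRep_apply, charRep_apply, TensorProduct.smul_tmul_smul, TensorProduct.tmul_smul,
    mul_comm, scalar_eq]

theorem nonempty_equiv_of_intertwinesAt_one (h : ∀ α, IntertwinesAt ρ σ Φ α 1) :
    Nonempty (ρ.Equiv σ) :=
  ⟨.mk Φ fun α ↦ LinearMap.ext fun v ↦ (h α v).trans (one_smul ℂ _)⟩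

end Mp

/-! ### The action on theta functions -/

namespace IntegralLattice

variable {L : IntegralLattice.{u}} {M : IntegralLattice.{v}}

theorem theta_mem_Theta (l : L.W) : L.theta l.1 ∈ L.Theta :=
  Submodule.subset_span ⟨l.1, l.2, rfl⟩

theorem IsPosDef.slash_mem_Theta (hL : L.IsPosDef) (α : Mp) {f : ℍ → L.CplxSpace → ℂ}
    (hf : f ∈ L.Theta) : L.slash f α ∈ L.Theta := by
  obtain ⟨F⟩ := hL.nonempty_orthFrame
  have exists_eq_theta {f : ℍ → L.CplxSpace → ℂ} (hf : f ∈ L.Theta) :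
      ∃ l : L.W, L.theta l.1 = f := by
    rwa [← F.range_thetaMap] at hf
  let N : Submonoid Mp :=
    { carrier := {α | ∀ f ∈ L.Theta, L.slash f α ∈ L.Theta}
      one_mem' := fun f hf ↦ by rwa [slash_one]
      mul_mem' := fun {α β} hα hβ f hf ↦ by
        rw [slash_mul]
        exact hβ _ (hα _ hf) }
  have N_eq_top : N = ⊤ := by
    refine Mp.submonoid_eq_top (fun f hf ↦ ?_) fun f hf ↦ ?_
    · obtain ⟨l, rfl⟩ := exists_eq_theta hf
      rw [F.slash_S_theta]
      exact L.Theta.smul_mem _ (theta_mem_Theta _)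
    · obtain ⟨l, rfl⟩ := exists_eq_theta hf
      rw [slash_T_theta]
      exact theta_mem_Theta _
  exact (N_eq_top ▸ Submonoid.mem_top α : α ∈ N) f hf

/-- The space of theta functions as a subrepresentation. -/
def IsPosDef.thetaRep (hL : L.IsPosDef) : Subrepresentation L.slashRep where
  toSubmodule := L.Theta
  apply_mem_toSubmodule α _ hf := hL.slash_mem_Theta α⁻¹ hf

/-- The representation of `Mp` on the space of theta functions. -/
abbrev IsPosDef.rep (hL : L.IsPosDef) : Representation ℂ Mp L.Theta :=
  hL.thetaRep.toRepresentation

namespace OrthFrame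

variable (F : L.OrthFrame) (hL : L.IsPosDef)

theorem rep_T_inv (l : L.W) :
    hL.rep Mp.T⁻¹ (F.thetaEquiv l) = F.thetaEquiv (mulPhase l) :=
  Subtype.ext <| (congrArg (L.slash _) (inv_inv Mp.T)).trans (slash_T_theta l)

theorem rep_S_inv (l : L.W) : hL.rep Mp.S⁻¹ (F.thetaEquiv l) =
    (F.fourierConst * e (-(L.rank / 8)) : ℂ) • F.thetaEquiv (fourierTransform l) :=
  Subtype.ext <| (congrArg (L.slash _) (inv_inv Mp.S)).trans (F.slash_S_theta l)

variable (G : M.OrthFrame) (hM : M.IsPosDef)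

/-- The isomorphism of spaces of theta functions that corresponds to `Ψ : W(L) ≃ W(M)`. -/
def thetaCongr (Ψ : L.W ≃ₗ[ℂ] M.W) : L.Theta ≃ₗ[ℂ] M.Theta :=
  (F.thetaEquiv.symm.trans Ψ).trans G.thetaEquiv

variable {Ψ : L.W ≃ₗ[ℂ] M.W} {k : ℚ} (hΨ : Intertwines Ψ k)

theorem thetaCongr_thetaEquiv (l : L.W) :
    F.thetaCongr G Ψ (F.thetaEquiv l) = G.thetaEquiv (Ψ l) := by
  simp [thetaCongr]

include hΨ

theorem intertwinesAt_T :
    IntertwinesAt hL.rep hM.rep (F.thetaCongr G Ψ) Mp.T (e (-(k / 2))) := by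
  have at_T_inv : IntertwinesAt hL.rep hM.rep (F.thetaCongr G Ψ) Mp.T⁻¹ (e (k / 2)) := by
    intro f
    obtain ⟨l, rfl⟩ := F.thetaEquiv.surjective f
    rw [rep_T_inv, thetaCongr_thetaEquiv, thetaCongr_thetaEquiv, rep_T_inv, hΨ.map_mulPhase,
      map_smul]
    push_cast
    rfl
  rw [e_neg, ← inv_inv Mp.T]
  exact at_T_inv.inv (e_ne_zero _)

theorem intertwinesAt_S_inv :
    IntertwinesAt hL.rep hM.rep (F.thetaCongr G Ψ) Mp.S⁻¹
      ((F.fourierConst / G.fourierConst : ℝ) * e ((M.rank - L.rank) / 8 - k : ℚ)) := by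
  intro f
  obtain ⟨l, rfl⟩ := F.thetaEquiv.surjective f
  have const_ne_zero := Complex.ofReal_ne_zero.2 G.fourierConst_pos.ne'
  have phase_eq : e (-(L.rank / 8)) * e (-k) =
      e ((M.rank - L.rank) / 8 - k : ℚ) * e (-(M.rank / 8)) := by
    rw [← e_add, ← e_add]
    congr 1
    push_cast
    ring
  rw [rep_S_inv, map_smul, thetaCongr_thetaEquiv, thetaCongr_thetaEquiv, rep_S_inv,
    hΨ.map_fourierTransform, map_smul, smul_smul, smul_smul, mul_assoc, phase_eq]
  push_cast
  field_simp

theorem exists_intertwinesAt_S : ∃ r : ℝ, 0 < r ∧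
    IntertwinesAt hL.rep hM.rep (F.thetaCongr G Ψ) Mp.S
      (r * e ((L.rank - M.rank) / 8 + k : ℚ)) := by
  have ratio_pos := div_pos F.fourierConst_pos G.fourierConst_pos
  refine ⟨_, inv_pos.2 ratio_pos, ?_⟩
  have at_S := (F.intertwinesAt_S_inv hL G hM hΨ).inv
    (mul_ne_zero (Complex.ofReal_ne_zero.2 ratio_pos.ne') (e_ne_zero _))
  rw [inv_inv, mul_inv, ← Complex.ofReal_inv, ← e_neg] at at_S
  convert at_S using 3
  push_cast
  ring

end OrthFrame

/-- Taking absolute values in the relation `s * t ^ 3 = 1` between the scalars at `S` and at `T`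
shows that the positive factor of `s`, the quotient of the constants of the two Fourier
transforms, is `1`. -/
theorem Intertwines.e_neg_half_eq {Ψ : L.W ≃ₗ[ℂ] M.W} {k : ℚ} (hΨ : Intertwines Ψ k)
    (hL : L.IsPosDef) (hM : M.IsPosDef) [Nontrivial L.Theta] :
    e (-(k / 2)) = e ((M.rank - L.rank) / 8) := by
  obtain ⟨F⟩ := hL.nonempty_orthFrame
  obtain ⟨G⟩ := hM.nonempty_orthFrame
  obtain ⟨r, r_pos, at_S⟩ := F.exists_intertwinesAt_S hL G hM hΨ
  have relation := at_S.scalar_S_mul_scalar_T_pow (F.intertwinesAt_T hL G hM hΨ)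
    (mul_ne_zero (Complex.ofReal_ne_zero.2 r_pos.ne') (e_ne_zero _))
  rw [mul_assoc, ← e_natCast_mul, ← e_add] at relation
  have phase_eq_one : e ((L.rank - M.rank) / 8 - k / 2 : ℚ) = 1 := by
    refine e_eq_one_of_ofReal_mul_e_eq_one r_pos ?_
    convert relation using 3
    push_cast
    ring
  rw [← mul_one (e ((M.rank - L.rank) / 8)), ← phase_eq_one, ← e_add]
  congr 1
  push_cast
  ring

theorem Intertwines.exists_intertwinesAt {Ψ : L.W ≃ₗ[ℂ] M.W} {k : ℚ} (hΨ : Intertwines Ψ k)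
    (hL : L.IsPosDef) (hM : M.IsPosDef) : ∃ Φ : L.Theta ≃ₗ[ℂ] M.Theta,
      ∀ χ : Mp →* ℂˣ, χ Mp.T = e (-(k / 2)) → ∀ α, IntertwinesAt hL.rep hM.rep Φ α (χ α) := by
  obtain ⟨F⟩ := hL.nonempty_orthFrame
  obtain ⟨G⟩ := hM.nonempty_orthFrame
  obtain ⟨r, r_pos, at_S⟩ := F.exists_intertwinesAt_S hL G hM hΨ
  refine ⟨F.thetaCongr G Ψ, fun χ hχ ↦ at_S.of_character ?_ ?_⟩
  · exact hχ ▸ F.intertwinesAt_T hL G hM hΨ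
  · exact mul_ne_zero (Complex.ofReal_ne_zero.2 r_pos.ne') (e_ne_zero _)

theorem StablyEquivalent.nonempty_equiv (hL : L.IsPosDef) (hM : M.IsPosDef)
    (h : L.StablyEquivalent M) :
    Nonempty ((hL.rep.tprod (charRep (epsilon ^ (3 * L.rank)))).Equiv
      (hM.rep.tprod (charRep (epsilon ^ (3 * M.rank))))) := by
  obtain ⟨U, V, hU, hV, isometric⟩ := h
  obtain ⟨s⟩ := hU.shadow_nonempty
  obtain ⟨t⟩ := hV.shadow_nonempty
  obtain ⟨Ψ, hΨ⟩ := exists_intertwines hU hV s t isometric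
  obtain ⟨Φ, hΦ⟩ := hΨ.exists_intertwinesAt hL hM
  refine nonempty_equiv_tprod_charRep (Φ := Φ) fun α ↦ ?_
  rcases subsingleton_or_nontrivial L.Theta
  · exact .of_subsingleton
  · refine hΦ _ ?_ α
    rw [hΨ.e_neg_half_eq hL hM, MonoidHom.div_apply, MonoidHom.pow_apply, MonoidHom.pow_apply,
      Units.val_div_eq_div_val, Units.val_pow_eq_pow_val, Units.val_pow_eq_pow_val, Mp.epsilon_T,
      ← e_natCast_mul, ← e_natCast_mul, ← e_sub]
    congr 1
    push_cast
    ring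

theorem EvenStablyEquivalent.nonempty_equiv (hL : L.IsPosDef) (hM : M.IsPosDef)
    (h : L.EvenStablyEquivalent M) : Nonempty (hL.rep.Equiv hM.rep) := by
  obtain ⟨U, V, ⟨hU, U_even⟩, ⟨hV, V_even⟩, isometric⟩ := h
  obtain ⟨Ψ, hΨ⟩ :=
    exists_intertwines hU hV ⟨0, U_even.zero_mem_shadow⟩ ⟨0, V_even.zero_mem_shadow⟩ isometric
  obtain ⟨Φ, hΦ⟩ := hΨ.exists_intertwinesAt hL hM
  exact nonempty_equiv_of_intertwinesAt_one (hΦ 1 (by simp [e_zero]))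

end IntegralLattice

end

end LatticeTheta

theorem theorem2p6 (L₁ : LatticeTheta.IntegralLattice.{u}) (L₂ : LatticeTheta.IntegralLattice.{v})
    (h₁ : L₁.IsPosDef) (h₂ : L₂.IsPosDef) :
    ∃ (Θ₁ : Subrepresentation L₁.slashRep) (Θ₂ : Subrepresentation L₂.slashRep),
      Θ₁.toSubmodule = L₁.Theta ∧ Θ₂.toSubmodule = L₂.Theta ∧
      (L₁.StablyEquivalent L₂ →
        Nonempty ((Θ₁.toRepresentation.tprod (LatticeTheta.charRep (LatticeTheta.epsilon ^ (3 * L₁.rank)))).Equiv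
          (Θ₂.toRepresentation.tprod (LatticeTheta.charRep (LatticeTheta.epsilon ^ (3 * L₂.rank)))))) ∧
      (L₁.EvenStablyEquivalent L₂ →
        Nonempty (Θ₁.toRepresentation.Equiv Θ₂.toRepresentation)) :=
  ⟨h₁.thetaRep, h₂.thetaRep, rfl, rfl,
    fun h ↦ h.nonempty_equiv h₁ h₂, fun h ↦ h.nonempty_equiv h₁ h₂⟩
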